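/- Let $N\ge 0$, let $\mathcal U=\mathbb Z\langle u_1,\dots,u_N\rangle$ be the free associative ring, and write $[m]=\{1,\dots,m\}$ and $\mathbf u_{\mathsf w}=u_{\mathsf w_1}\cdots u_{\mathsf w_d}$ for a word $\mathsf w=\mathsf w_1\cdots \mathsf w_d$ in the alphabet $[N]$. For $S\subset[N]$ and $k\in\mathbb Z$ let $e_k(\mathbf u_S)=\sum_{i_1>\cdots>i_k,\ i_r\in S}u_{i_1}\cdots u_{i_k}$ (with $e_0=1$ and $e_k=0$ for $k<0$ or $k>|S|$), and write $e_k(\mathbf u)$ for $S=[N]$; for $k\ge 0$ let $h_k(\mathbf u)=\sum_{1\le i_1\le\cdots\le i_k\le N}u_{i_1}\cdots u_{i_k}$. Let $I_{\rm B}$ be the two-sided ideal of $\mathcal U$ generated by the elements $$u_b^2u_a+u_au_bu_a-u_bu_au_b-u_bu_a^2\quad(a<b),\qquad u_bu_cu_a-u_bu_au_c,\quad u_au_cu_b-u_cu_au_b\quad(a<b<c).$$ For a partition $\lambda$ with conjugate $\lambda'$ and $t=\lambda_1$, the noncommutative Schur function is $$\mathfrak J_\lambda(\mathbf u)=\sum_{\pi\in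 S_t}\operatorname{sgn}(\pi)\,e_{\lambda'_1+\pi(1)-1}(\mathbf u)\cdots e_{\lambda'_t+\pi(t)-t}(\mathbf u).$$ For $\alpha\in\mathbb Z_{\ge0}^l$ and $\mathbf n\in\{0,\dots,N\}^l$, the column-flagged version is $$J_\alpha(\mathbf n)=\sum_{\pi\in S_l}\operatorname{sgn}(\pi)\,e_{\alpha_1+\pi(1)-1}(\mathbf u_{[n_1]})\cdots e_{\alpha_l+\pi(l)-l}(\mathbf u_{[n_l]}),$$ so that $\mathfrak J_\lambda(\mathbf u)=J_{\lambda'}(N,\dots,N)$. Let $\alpha'=\{(i,j): j\in[l],\ i\in[\alpha_j]\}$, where $i$ is the row and $j$ the column. Let $\mathrm{SSYT}(\alpha')^{\mathbf n}$ be the set of fillings $T:\alpha'\to[N]$ whose entries weakly increase across the rows and strictly increase down the columns, whose entries in column $j$ lie in $[n_j]$, and such that $T(\alpha_{j+1},j+1)>n_j$ whenever $\alpha_j<\alpha_{j+1}$. The diagonal reading word $\mathrm{diagread}(T)$ concatenates the diagonals of $T$ (the sets of cells with $j-i$ constant), each read in the southeast direction, starting with the southwesternmost diagonal. Let $\mathcal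 U^*$ be the free $\mathbb Z$-module on the words in the alphabet $[N]$, paired with $\mathcal U$ by $\langle \mathbf u_{\mathsf w},\mathsf v\rangle=\delta_{\mathsf v\mathsf w}$; let $\mathcal U_{\ge0}$ and $\mathcal U^*_{\ge0}$ be the sets of nonnegative integer combinations of monomials and of words, respectively, and let $I_{\rm B}^\perp=\{\gamma\in\mathcal U^*:\langle z,\gamma\rangle=0\text{ for all }z\in I_{\rm B}\}$. For $\gamma\in\mathcal U^*$ put $F_\gamma(\mathbf x)=\big\langle\prod_{j=1}^{\infty}\sum_{k\ge0}x_j^kh_k(\mathbf u),\,\gamma\big\rangle\in\mathbb Z[[x_1,x_2,\dots]]$, where the factors are multiplied from left to right, the $x_j$ commute with each other and with the $u_i$, and the pairing is taken coefficientwise in $\mathbf x$. **Theorem.** 1. For every partition $\lambda$, the noncommutative Schur function $\mathfrak J_\lambda(\mathbf u)$ is $\mathbb Z$-monomial positive modulo $I_{\rm B}$, i.e. $\mathfrak J_\lambda(\mathbf u)\in\mathcal U_{\ge0}+I_{\rm B}$. 2. Explicitly, if $\alpha\in\mathbb Z_{\ge0}^l$ satisfies $\alpha_{j+1}\le\alpha_j+1$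 for all $1\le j<l$, and $0\le n_1\le\cdots\le n_l\le N$, then $$J_\alpha(\mathbf n)\equiv\sum_{T\in\mathrm{SSYT}(\alpha')^{\mathbf n}}\mathbf u_{\mathrm{diagread}(T)}\pmod{I_{\rm B}}.$$ 3. Consequently, for every $\gamma\in\mathcal U^*_{\ge0}\cap I_{\rm B}^\perp$, the power series $F_\gamma(\mathbf x)$ is Schur positive, i.e. it is a finite linear combination, with nonnegative integer coefficients, of Schur functions $s_\lambda(\mathbf x)$. -/

import Mathlib

/-! The alphabet `{1, …, N}` is modelled by `Fin N`: the letter `a` is the element of `Fin N` with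
value `a - 1`.  Rows, columns, and the commuting variables `x₁, x₂, …` are likewise indexed from
`0`. -/

namespace NCSchur

noncomputable section

/-- The free associative ring `U = ℤ⟨u₁, …, u_N⟩`. -/
abbrev U (N : ℕ) : Type := FreeAlgebra ℤ (Fin N)

/-- The generator attached to a letter. -/
def u {N : ℕ} (a : Fin N) : U N := FreeAlgebra.ι ℤ a

/-- The noncommutative monomial `u_w = u_{w₁} ⋯ u_{w_n}` of a word `w`. -/
def mon {N : ℕ} (w : List (Fin N)) : U N := (w.map u).prod

/-- The noncommutative elementary symmetric function `e_k(u_S)`: the sum over all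
`i₁ > ⋯ > i_k` in `S` of `u_{i₁} ⋯ u_{i_k}`; it is `0` for `k < 0` and for `k > |S|`. -/
def e {N : ℕ} (S : Finset (Fin N)) (k : ℤ) : U N :=
  if 0 ≤ k then ∑ A ∈ S.powersetCard k.toNat, mon (A.sort (fun a b => b ≤ a)) else 0

/-- The noncommutative complete homogeneous symmetric function `h_k(u)`: the sum over all
`i₁ ≤ ⋯ ≤ i_k` of `u_{i₁} ⋯ u_{i_k}`. -/
def h (N k : ℕ) : U N :=
  ∑ f : Fin k → Fin N with Monotone f, mon (List.ofFn f)

/-- The set of letters `[m] = {1, …, m}`, for `m ≤ N`. -/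
def letters (N m : ℕ) : Finset (Fin N) := Finset.univ.filter fun a => (a : ℕ) < m

/-- The noncommutative Schur function
`𝔍_μ(u) = ∑_π sgn(π) e_{μ'₁ + π(1) - 1}(u) ⋯ e_{μ'_t + π(t) - t}(u)`, with `π` running over the
permutations of `{1, …, t}`, where `t = μ₁`. -/
def ncSchur (N : ℕ) (μ : YoungDiagram) : U N :=
  ∑ π : Equiv.Perm (Fin (μ.rowLen 0)),
    ((Equiv.Perm.sign π : ℤˣ) : ℤ) •
      (List.ofFn fun j : Fin (μ.rowLen 0) =>
        e (Finset.univ : Finset (Fin N))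
          ((μ.colLen (j : ℕ) : ℤ) + ((π j : ℕ) : ℤ) - ((j : ℕ) : ℤ))).prod

/-- The noncommutative column-flagged Schur function
`J_α(n) = ∑_π sgn(π) e_{α₁ + π(1) - 1}(u_{[n₁]}) ⋯ e_{α_l + π(l) - l}(u_{[n_l]})`. -/
def flaggedSchur (N : ℕ) {l : ℕ} (α n : Fin l → ℕ) : U N :=
  ∑ π : Equiv.Perm (Fin l),
    ((Equiv.Perm.sign π : ℤˣ) : ℤ) •
      (List.ofFn fun j : Fin l =>
        e (letters N (n j)) ((α j : ℤ) + ((π j : ℕ) : ℤ) - ((j : ℕ) : ℤ))).prod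

/-- The generators of the ideal `I_B`. -/
inductive IsGenB (N : ℕ) : U N → Prop
  | twoVar (a b : Fin N) (hab : a < b) :
      IsGenB N (u b ^ 2 * u a + u a * u b * u a - u b * u a * u b - u b * u a ^ 2)
  | knuth₁ (a b c : Fin N) (hab : a < b) (hbc : b < c) :
      IsGenB N (u b * u c * u a - u b * u a * u c)
  | knuth₂ (a b c : Fin N) (hab : a < b) (hbc : b < c) :
      IsGenB N (u a * u c * u b - u c * u a * u b)

/-- The two-sided ideal `I_B`. -/
def idealB (N : ℕ) : TwoSidedIdeal (U N) := TwoSidedIdeal.span {f | IsGenB N f}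

/-- The cone `U_{≥ 0}`: the nonnegative integer combinations of noncommutative monomials. -/
def nonnegCone (N : ℕ) : AddSubmonoid (U N) := AddSubmonoid.closure (Set.range mon)

/-- `f` is `ℤ`-monomial positive modulo `I`, i.e. `f ∈ U_{≥ 0} + I`. -/
def IsMonomialPositive {N : ℕ} (I : TwoSidedIdeal (U N)) (f : U N) : Prop :=
  ∃ g ∈ nonnegCone N, f - g ∈ I

/-- Fillings of the diagram `α'` whose `j`-th column has `α j` cells, with entries in the alphabet;
`T j i` is the entry in row `i` and column `j`. -/
abbrev Filling (N : ℕ) {l : ℕ} (α : Fin l → ℕ) : Type := (j : Fin l) → Fin (α j) → Fin N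

/-- The defining conditions of `SSYT(α')ⁿ`.  As letters are shifted by one, `a ∈ [m]` reads
`(a : ℕ) < m` and `a > m` reads `m ≤ (a : ℕ)`. -/
structure IsFlaggedSSYT {N l : ℕ} (α n : Fin l → ℕ) (T : Filling N α) : Prop where
  row_weak : ∀ (j k : Fin l), j < k → ∀ (i : ℕ) (hj : i < α j) (hk : i < α k),
    T j ⟨i, hj⟩ ≤ T k ⟨i, hk⟩
  col_strict : ∀ j : Fin l, StrictMono (T j)
  flag : ∀ (j : Fin l) (i : Fin (α j)), (T j i : ℕ) < n j
  bottom : ∀ (j k : Fin l), (k : ℕ) = j + 1 → α j < α k →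
    ∀ i : Fin (α k), (i : ℕ) + 1 = α k → n j ≤ (T k i : ℕ)

open Classical in
/-- The finite set `SSYT(α')ⁿ`. -/
def flaggedSSYT (N : ℕ) {l : ℕ} (α n : Fin l → ℕ) : Finset (Filling N α) :=
  Finset.univ.filter fun T => IsFlaggedSSYT α n T

/-- The diagonal reading word of `T`: the diagonals are read in the southeast direction, starting
with the southwesternmost one.  With `R` the number of rows, the `d`-th list collects, by
increasing column `j`, the cells in row `j + R - d`, i.e. the diagonal
`column - row = d - R`. -/
def diagread {N l : ℕ} {α : Fin l → ℕ} (T : Filling N α) : List (Fin N) :=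
  (List.range (Finset.univ.sup α + l)).flatMap fun d =>
    (List.finRange l).filterMap fun j : Fin l =>
      if hc : d ≤ (j : ℕ) + Finset.univ.sup α ∧ (j : ℕ) + Finset.univ.sup α - d < α j then
        some (T j ⟨(j : ℕ) + Finset.univ.sup α - d, hc.2⟩)
      else none

/-- `U*`, the free `ℤ`-module on the words in the alphabet. -/
abbrev UStar (N : ℕ) : Type := List (Fin N) →₀ ℤ

/-- The coefficient of the monomial `u_w` in `f`. -/
def wordCoeff {N : ℕ} (f : U N) (w : List (Fin N)) : ℤ :=
  (FreeAlgebra.equivMonoidAlgebraFreeMonoid f).coeff (FreeMonoid.ofList w)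

/-- The pairing of `U` and `U*` in which monomials are dual to words. -/
def pairing {N : ℕ} (f : U N) (γ : UStar N) : ℤ := γ.sum fun w c => wordCoeff f w * c

/-- Words and monomials are dual bases. -/
theorem pairing_mon {N : ℕ} (v w : List (Fin N)) :
    pairing (mon v) (Finsupp.single w 1) = if v = w then 1 else 0 := by
  have key : (FreeAlgebra.equivMonoidAlgebraFreeMonoid (mon v) :
      MonoidAlgebra ℤ (FreeMonoid (Fin N))) = MonoidAlgebra.single (FreeMonoid.ofList v) 1 := by
    induction v with
    | nil => simp [mon, MonoidAlgebra.one_def]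
    | cons a v ih =>
      have : (mon (a :: v) : U N) = u a * mon v := by simp [mon]
      rw [this, map_mul, ih]
      simp [u, FreeAlgebra.equivMonoidAlgebraFreeMonoid, MonoidAlgebra.of_apply,
        MonoidAlgebra.single_mul_single, FreeMonoid.ofList_cons]
  rw [pairing, Finsupp.sum_single_index (by simp), wordCoeff, key, MonoidAlgebra.coeff_single,
    mul_one]
  by_cases hvw : v = w
  · subst hvw
    rw [if_pos rfl, Finsupp.single_eq_same]
  · rw [if_neg hvw, Finsupp.single_eq_of_ne]
    exact fun hc => hvw (FreeMonoid.ofList.injective hc.symm)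

/-- `γ ∈ I^⊥`. -/
def IsOrthogonal {N : ℕ} (I : TwoSidedIdeal (U N)) (γ : UStar N) : Prop :=
  ∀ z ∈ I, pairing z γ = 0

/-- `γ ∈ U*_{≥ 0}`: all coefficients of `γ` are nonnegative. -/
def IsNonneg {N : ℕ} (γ : UStar N) : Prop := ∀ w, 0 ≤ γ w

/-- `H(x_j) = ∑_k x_j^k h_k(u)`, a power series in the commuting variables `x`. -/
def H (N j : ℕ) : MvPowerSeries ℕ (U N) :=
  fun m => if m.support ⊆ {j} then h N (m j) else 0

/-- The noncommutative Cauchy product `Ω(x, u) = H(x₁) H(x₂) ⋯`.  The coefficient of `x^m` in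
`H(x₁) ⋯ H(x_k)` does not depend on `k` once `x₁, …, x_k` include all the variables of `x^m`; this
is the coefficient of `x^m` in the infinite product. -/
def cauchyProduct (N : ℕ) : MvPowerSeries ℕ (U N) :=
  fun m => ((List.range (m.support.sup Nat.succ)).map fun j => h N (m j)).prod

/-- The defining formula of `cauchyProduct` is the value of all long enough partial products. -/
theorem coeff_prod_H (N k : ℕ) (m : ℕ →₀ ℕ) (hm : m.support ⊆ Finset.range k) :
    MvPowerSeries.coeff m ((List.range k).map (H N)).prod =
      MvPowerSeries.coeff m (cauchyProduct N) := by
  have h0 : h N 0 = 1 := by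
    have : (Finset.univ.filter fun f : Fin 0 → Fin N => Monotone f) = {default} := by
      ext f
      simp only [Finset.mem_filter, Finset.mem_univ, true_and, Finset.mem_singleton]
      exact ⟨fun _ => Subsingleton.elim _ _, fun _ a => a.elim0⟩
    rw [h, this]
    simp [mon]
  have main : ∀ (k : ℕ) (m : ℕ →₀ ℕ),
      MvPowerSeries.coeff m ((List.range k).map (H N)).prod =
        if m.support ⊆ Finset.range k then
          ((List.range k).map fun j => h N (m j)).prod else 0 := by
    intro k
    induction k with
    | zero =>
      intro m
      simp [MvPowerSeries.coeff_one]
    | succ k ih =>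
      intro m
      have hH : ∀ q : ℕ →₀ ℕ, MvPowerSeries.coeff q (H N k) =
          if q.support ⊆ {k} then h N (q k) else 0 := fun q => rfl
      rw [List.range_succ, List.map_append, List.prod_append, List.map_append, List.prod_append,
        MvPowerSeries.coeff_mul]
      simp only [List.map_cons, List.map_nil, List.prod_cons, List.prod_nil, mul_one]
      rw [Finset.sum_eq_single (m.erase k, Finsupp.single k (m k))]
      · rw [ih, hH, if_pos Finsupp.support_single_subset, Finsupp.single_eq_same]
        have hiff : (m.erase k).support ⊆ Finset.range k ↔
            m.support ⊆ Finset.range (k + 1) := by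
          rw [Finsupp.support_erase, Finset.range_add_one, Finset.subset_insert_iff]
        by_cases hs : m.support ⊆ Finset.range (k + 1)
        · rw [if_pos (hiff.2 hs), if_pos hs]
          congr 2
          refine List.map_congr_left fun j hj => ?_
          rw [Finsupp.erase_ne (List.mem_range.1 hj).ne]
        · rw [if_neg (fun hc => hs (hiff.1 hc)), if_neg hs, zero_mul]
      · rintro ⟨p, q⟩ hpq hne
        rw [Finset.HasAntidiagonal.mem_antidiagonal] at hpq
        rw [ih, hH]
        split_ifs with hp hq
        · exfalso
          apply hne
          have hpk : p k = 0 := by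
            by_contra hc
            exact absurd (Finset.mem_range.1 (hp (Finsupp.mem_support_iff.2 hc))) (lt_irrefl k)
          have hqj : ∀ j, j ≠ k → q j = 0 := by
            intro j hj
            by_contra hc
            exact hj (Finset.mem_singleton.1 (hq (Finsupp.mem_support_iff.2 hc)))
          simp only at hpq
          subst hpq
          refine Prod.ext (Finsupp.ext fun j => ?_) (Finsupp.ext fun j => ?_)
          · by_cases hj : j = k
            · subst hj
              simp [hpk]
            · simp [Finsupp.erase_ne hj, hqj j hj]
          · by_cases hj : j = k
            · subst hj
              simp [hpk]
            · simp [hqj j hj, Ne.symm hj]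
        all_goals simp
      · intro hc
        exact absurd (Finset.HasAntidiagonal.mem_antidiagonal.2 (m.erase_add_single k)) hc
  have hrange : ∀ k, m.support ⊆ Finset.range k →
      ((List.range k).map fun j => h N (m j)).prod = cauchyProduct N m := by
    intro k
    induction k with
    | zero =>
      intro hk
      have : m = 0 := by simpa using hk
      subst this
      simp [cauchyProduct]
    | succ k ih =>
      intro hk
      by_cases hmk : m k = 0
      · rw [List.range_succ, List.map_append, List.prod_append]
        simp only [List.map_cons, List.map_nil, List.prod_cons, List.prod_nil, mul_one, hmk, h0]
        refine ih fun j hj => ?_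
        have h1 := Finset.mem_range.1 (hk hj)
        have h2 : j ≠ k := by
          rintro rfl
          exact Finsupp.mem_support_iff.1 hj hmk
        exact Finset.mem_range.2 (by omega)
      · have : m.support.sup Nat.succ = k + 1 := by
          apply le_antisymm
          · refine Finset.sup_le fun j hj => ?_
            exact Finset.mem_range.1 (hk hj)
          · exact Finset.le_sup (f := Nat.succ) (Finsupp.mem_support_iff.2 hmk)
        rw [cauchyProduct, this]
  rw [main, if_pos hm, hrange k hm]
  rfl

/-- `F_γ(x) = ⟨Ω(x, u), γ⟩`, the pairing being taken coefficientwise in `x`. -/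
def F {N : ℕ} (γ : UStar N) : MvPowerSeries ℕ ℤ := fun m => pairing (cauchyProduct N m) γ

/-- The Schur function `s_μ(x)` in infinitely many variables: the coefficient of `x^m` is the number
of semistandard Young tableaux of shape `μ` in which each `i` occurs `m i` times. -/
def schur (μ : YoungDiagram) : MvPowerSeries ℕ ℤ := fun m =>
  (Nat.card {T : SemistandardYoungTableau μ //
    ∀ i : ℕ, (μ.cells.filter fun c => T c.1 c.2 = i).card = m i} : ℤ)

/-- `f` is Schur positive: it is a nonnegative integer combination of Schur functions. -/
def IsSchurPositive (f : MvPowerSeries ℕ ℤ) : Prop :=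
  ∃ c : YoungDiagram →₀ ℕ, f = c.sum fun μ k => k • schur μ

end

end NCSchur

/-!
# Positivity of noncommutative Schur functions modulo the ideal `I_B`

Everything takes place in a ring with letters `v 0, v 1, …` satisfying the relations that generate
`I_B` (`SatisfiesB`), in particular in `U / I_B`.

*Commutation.*  The elementary symmetric functions of an initial segment of the alphabet commute
(`elem_mul_comm`).  In terms of generating functions, the products of the factors `1 + t v_i` over
an interval of letters, in decreasing order, have to commute for two central parameters.  By the
Knuth relations the commutator of the extreme letters of the interval absorbs the factors of the
letters in between, and by the two-variable relation it intertwines the factors of the extreme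
letters, so that the claim for the interval follows from the claims for the three smaller intervals
without its first letter, its last letter, or both.  Furthermore, to the right of a letter `b` the
elementary symmetric functions of the letters less than `b` commute with increasing words in letters
greater than `b` (`mul_elem_mul_prod`).

*Expansion of the flagged functions.*  The determinant `J_α(n)` is expanded one cell at a time:
diagonal by diagonal, starting in the southwest, and within a diagonal from right to left.  If
column `j` is up for expansion, the column before it ends exactly one row higher, and
`e_k(u_{[n_j]}) = e_k(u_{[m]}) + ∑_{m ≤ x < n_j} u_x e_{k-1}(u_{[x]})` with `m` the flag of that
column (for the first column, `m = 0`).  The first summand gives a determinant with a zero column, or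
in which two adjacent columns have the same commuting entries, hence `0`; in the others the new
letter `x` becomes the flag of column `j`, and the word of the letters already found on the diagonal
is moved to the left of the column (`ndet_expand_column`).  The choices made for `x` are precisely the flagged tableaux, and the words obtained are their
diagonal reading words (`isTabSum_diagWord`).  The noncommutative Schur functions are the special
case of constant flags, and are therefore monomial positive.

*Schur positivity.*  Since the `e_k(u)` commute modulo `I_B`, the classical proof of the Cauchy
identity can be carried out in the commutative subring of `U / I_B` that they generate.  The Pieri
rule (`jacobiTrudi_pieri`) compares shifts of the row indices of a Jacobi–Trudi determinant with shifts
of the column indices; iterating it writes `h_{m_0} h_{m_1} ⋯` as the sum of the Schur functions of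
the shapes of all semistandard tableaux of content `m` (`prod_complete_eq_sum`,
`toQuot_cauchyProduct`).  Pairing with `γ` gives `F_γ = ∑_μ ⟨𝔍_μ(u), γ⟩ s_μ`.  By the expansion
above, the coefficient of `s_μ` is a sum of coefficients of `γ`, hence nonnegative, and it vanishes
when `μ` has more cells than the longest word in `γ` has letters (`isSchurPositive_F`).
-/

namespace NCSchur

/-! ### Elementary symmetric functions in a ring satisfying the relations of the ideal -/

/-- The relations generating the ideal `I_B`, for letters `v 0, v 1, …` of an arbitrary ring.
A finite alphabet is covered by letting all but finitely many letters be `0`. -/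
structure SatisfiesB {A : Type*} [Ring A] (v : ℕ → A) : Prop where
  twoVar : ∀ a b, a < b → v b ^ 2 * v a + v a * v b * v a = v b * v a * v b + v b * v a ^ 2
  knuth₁ : ∀ a b c, a < b → b < c → v b * v c * v a = v b * v a * v c
  knuth₂ : ∀ a b c, a < b → b < c → v a * v c * v b = v c * v a * v b

/-- The elementary symmetric function `e_k` of the first `m` letters, defined by recursion on `m`:
the largest letter, if it occurs, comes first. -/
def elem {A : Type*} [Ring A] (v : ℕ → A) : ℕ → ℤ → A
  | 0, k => if k = 0 then 1 else 0
  | m + 1, k => elem v m k + v m * elem v m (k - 1)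

section Elem

variable {A : Type*} [Ring A] (v : ℕ → A)

theorem elem_of_neg (m : ℕ) (k : ℤ) (hk : k < 0) : elem v m k = 0 := by
  induction m generalizing k with
  | zero => simp [elem, hk.ne]
  | succ m ih => simp [elem, ih k hk, ih (k - 1) (by omega)]

theorem elem_zero_right (m : ℕ) : elem v m 0 = 1 := by
  induction m with
  | zero => simp [elem]
  | succ m ih => simp [elem, ih, elem_of_neg v m (-1) (by omega)]

/-- Sorting the monomials of `e_k` of the first `n` letters by their largest letter `x ≥ m`. -/
theorem elem_eq_add_sum (m n : ℕ) (hmn : m ≤ n) (k : ℤ) :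
    elem v n k = elem v m k + ∑ x ∈ Finset.Ico m n, v x * elem v x (k - 1) := by
  induction n, hmn using Nat.le_induction with
  | base => simp
  | succ n hmn ih => rw [Finset.sum_Ico_succ_top hmn, ← add_assoc, ← ih, elem]

/-- The product `g (a + m - 1) ⋯ g (a + 1) g a` over an interval of `m` letters, in decreasing
order. -/
def decProd {B : Type*} [Monoid B] (g : ℕ → B) (a : ℕ) : ℕ → B
  | 0 => 1
  | m + 1 => g (a + m) * decProd g a m

theorem decProd_succ_left {B : Type*} [Monoid B] (g : ℕ → B) (a m : ℕ) :
    decProd g a (m + 1) = decProd g (a + 1) m * g a := by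
  induction m with
  | zero => simp [decProd]
  | succ m ih =>
    rw [decProd, ih, decProd, mul_assoc]
    congr 2
    omega

theorem isUnit_decProd {B : Type*} [Monoid B] (g : ℕ → B) (hg : ∀ i, IsUnit (g i)) (a m : ℕ) :
    IsUnit (decProd g a m) := by
  induction m with
  | zero => exact isUnit_one
  | succ m ih => exact (hg _).mul ih

/-- The step from the intervals `(a, c]`, `[a, c)` and `(a, c)` to `[a, c]` in the proof that
the generating functions of elementary symmetric functions commute.  The factors of the letters `a`
and `c` in the two generating functions are `ga, ha` and `gc, hc`, and `G, H` are the products over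
the letters in between.  The commutator `κ` of `ga` and `hc` absorbs `G` and `H`, so it contributes
the same to both products, while the rest is handled by inverting `G` and `H`. -/
theorem mul_comm_of_commutator {B : Type*} [Ring B] {ga ha gc hc G H κ : B}
    (hG : IsUnit G) (hH : IsUnit H)
    (hκ : ga * hc = hc * ga + κ) (hκ' : ha * gc = gc * ha + κ)
    (hκ'' : gc * κ * ha = hc * κ * ga)
    (hGκ : G * κ = κ) (hHκ : H * κ = κ) (hκG : κ * G = κ) (hκH : κ * H = κ)
    (hGH : G * H = H * G)
    (hc_comm : gc * G * (hc * H) = hc * H * (gc * G))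
    (ha_comm : G * ga * (H * ha) = H * ha * (G * ga)) :
    gc * G * ga * (hc * H * ha) = hc * H * ha * (gc * G * ga) := by
  obtain ⟨G, rfl⟩ := hG
  obtain ⟨H, rfl⟩ := hH
  have h1 : gc * G * hc = hc * H * gc * G * (↑H⁻¹ : B) := by
    rw [Units.eq_mul_inv_iff_mul_eq]
    simpa only [mul_assoc] using hc_comm
  have h2 : ga * H * ha = (↑G⁻¹ : B) * (H * ha * G * ga) := by
    rw [Units.eq_inv_mul_iff_mul_eq]
    simpa only [mul_assoc] using ha_comm
  have hGH' : G * H = H * G := Units.ext hGH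
  have h3 : (G : B) * (↑H⁻¹ : B) * (↑G⁻¹ : B) * H = 1 := by
    have : G * H⁻¹ * G⁻¹ * H = 1 := by
      have : G⁻¹ * H = H * G⁻¹ := by
        rw [inv_mul_eq_iff_eq_mul, ← mul_assoc, hGH', mul_assoc, mul_inv_cancel, mul_one]
      rw [mul_assoc, this, mul_assoc G, inv_mul_cancel_left, mul_inv_cancel]
    simpa only [Units.val_mul, Units.val_one] using congrArg Units.val this
  have key : gc * G * (hc * ga) * (H * ha) = hc * H * (gc * ha) * (G * ga) := by
    calc gc * G * (hc * ga) * (H * ha) = (gc * G * hc) * (ga * H * ha) := by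
          simp only [mul_assoc]
      _ = hc * H * gc * (G * (↑H⁻¹ : B) * (↑G⁻¹ : B) * H) * ha * G * ga := by
          rw [h1, h2]; simp only [mul_assoc]
      _ = _ := by rw [h3]; simp only [mul_assoc, mul_one]
  calc gc * G * ga * (hc * H * ha) = gc * G * (ga * hc) * (H * ha) := by simp only [mul_assoc]
    _ = gc * G * (hc * ga) * (H * ha) + gc * ((G * κ) * H) * ha := by
        rw [hκ]; simp only [mul_add, add_mul, mul_assoc]
    _ = hc * H * (gc * ha) * (G * ga) + hc * ((H * κ) * G) * ga := by
        rw [key, hGκ, hHκ, hκH, hκG, hκ'']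
    _ = hc * H * (ha * gc) * (G * ga) := by
        rw [hκ']; simp only [mul_add, add_mul, mul_assoc]
    _ = _ := by simp only [mul_assoc]

/-- The generating functions `(1 + t v_{a+m-1}) ⋯ (1 + t v_a)` for two central parameters
commute. -/
theorem decProd_mul_comm {v : ℕ → A} (hv : SatisfiesB v) (t s : A) (ht : ∀ z, Commute t z)
    (hs : ∀ z, Commute s z) (htu : ∀ i, IsUnit (1 + t * v i)) (hsu : ∀ i, IsUnit (1 + s * v i))
    (m a : ℕ) :
    decProd (fun i => 1 + t * v i) a m * decProd (fun i => 1 + s * v i) a m =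
      decProd (fun i => 1 + s * v i) a m * decProd (fun i => 1 + t * v i) a m := by
  have comm1 : ∀ i, Commute (1 + t * v i) (1 + s * v i) := by
    intro i
    have : Commute (1 + t * v i) (v i) :=
      (Commute.one_left _).add_left ((ht _).mul_left (Commute.refl _))
    exact (Commute.one_right _).add_right ((hs _).symm.mul_right this)
  induction m using Nat.strong_induction_on generalizing a with
  | _ m ih =>
    match m with
    | 0 => simp [decProd]
    | 1 =>
      simpa only [decProd, mul_one] using (comm1 (a + 0)).eq
    | m + 2 =>
      set c := a + (m + 1) with hc
      have hac : a < c := by omega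
      have hbet : ∀ r : A, (∀ z, Commute r z) → ∀ b, a < b → b < c →
          (1 + r * v b) * (v a * v c - v c * v a) = v a * v c - v c * v a ∧
          (v a * v c - v c * v a) * (1 + r * v b) = v a * v c - v c * v a := by
        intro r hr b hab hbc
        have k1 := hv.knuth₁ a b c hab hbc
        have k2 := hv.knuth₂ a b c hab hbc
        constructor
        · rw [add_mul, one_mul, mul_assoc, mul_sub, ← mul_assoc, ← mul_assoc, k1, sub_self,
            mul_zero, add_zero]
        · rw [mul_add, mul_one, (hr _).eq, ← mul_assoc, sub_mul, k2, sub_self, zero_mul, add_zero]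
      have habs : ∀ r : A, (∀ z, Commute r z) → ∀ k, k ≤ m →
          decProd (fun i => 1 + r * v i) (a + 1) k * (v a * v c - v c * v a)
            = v a * v c - v c * v a ∧
          (v a * v c - v c * v a) * decProd (fun i => 1 + r * v i) (a + 1) k
            = v a * v c - v c * v a := by
        intro r hr k hk
        induction k with
        | zero => simp [decProd]
        | succ k ihk =>
          obtain ⟨i1, i2⟩ := ihk (by omega)
          obtain ⟨j1, j2⟩ := hbet r hr (a + 1 + k) (by omega) (by omega)
          constructor
          · rw [decProd, mul_assoc, i1, j1]
          · rw [decProd, ← mul_assoc, j2, i2]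
      have htw : (v a * v c - v c * v a) * v a = v c * (v a * v c - v c * v a) := by
        have := hv.twoVar a c hac
        rw [sub_mul, mul_sub, sub_eq_sub_iff_add_eq_add]
        simp only [pow_two, mul_assoc] at this ⊢
        rw [add_comm, this]
      have hts : ∀ z, Commute (t * s) z := fun z => (ht z).mul_left (hs z)
      have e1 : ∀ r q : A, (∀ z, Commute r z) → (∀ z, Commute q z) →
          (1 + r * v a) * (1 + q * v c) = (1 + q * v c) * (1 + r * v a)
            + r * q * (v a * v c - v c * v a) := by
        intro r q hr hq
        have a1 : r * v a * (q * v c) = r * q * (v a * v c) := by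
          rw [mul_assoc, ← mul_assoc (v a), ← (hq (v a)).eq]; simp only [mul_assoc]
        have a2 : q * v c * (r * v a) = r * q * (v c * v a) := by
          rw [mul_assoc, ← mul_assoc (v c), ← (hr (v c)).eq, (hr q).eq]; simp only [mul_assoc]
        simp only [add_mul, mul_add, one_mul, mul_one, a1, a2, mul_sub]
        abel
      have e2 : ∀ r : A, (∀ z, Commute r z) → (1 + r * v c) * (v a * v c - v c * v a) =
          (v a * v c - v c * v a) * (1 + r * v a) := by
        intro r hr
        rw [add_mul, mul_add, one_mul, mul_one, mul_assoc, ← htw, ← mul_assoc, (hr _).eq, mul_assoc]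
      have split : ∀ r : A, decProd (fun i => 1 + r * v i) a (m + 2) =
          (1 + r * v c) * decProd (fun i => 1 + r * v i) (a + 1) m * (1 + r * v a) := by
        intro r
        rw [decProd, decProd_succ_left, ← mul_assoc]
      have top : ∀ r : A, decProd (fun i => 1 + r * v i) (a + 1) (m + 1) =
          (1 + r * v c) * decProd (fun i => 1 + r * v i) (a + 1) m := by
        intro r
        rw [decProd]
        congr 4
        omega
      rw [split, split]
      refine mul_comm_of_commutator (κ := t * s * (v a * v c - v c * v a))
        (isUnit_decProd _ htu _ _) (isUnit_decProd _ hsu _ _) (e1 t s ht hs) ?_ ?_ ?_ ?_ ?_ ?_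
        (ih m (by omega) _) ?_ ?_
      · rw [e1 s t hs ht, (ht s).eq]
      · have pull : ∀ g x f : A, g * (t * s * x) * f = t * s * (g * x * f) := by
          intro g x f
          rw [← mul_assoc g, ← (hts g).eq]
          simp only [mul_assoc]
        rw [pull, pull, e2 t ht, mul_assoc _ (1 + t * v a), (comm1 a).eq, ← mul_assoc (_ - _),
          ← e2 s hs]
      · rw [← mul_assoc, ← (hts _).eq, mul_assoc, (habs t ht m le_rfl).1]
      · rw [← mul_assoc, ← (hts _).eq, mul_assoc, (habs s hs m le_rfl).1]
      · rw [mul_assoc, (habs t ht m le_rfl).2]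
      · rw [mul_assoc, (habs s hs m le_rfl).2]
      · have := ih (m + 1) (by omega) (a + 1)
        rwa [top, top] at this
      · have := ih (m + 1) (by omega) a
        rwa [decProd_succ_left, decProd_succ_left] at this

open PowerSeries in
/-- The elementary symmetric functions of the first `m` letters commute. -/
theorem elem_mul_comm {v : ℕ → A} (hv : SatisfiesB v) (m : ℕ) (k l : ℤ) :
    elem v m k * elem v m l = elem v m l * elem v m k := by
  rcases lt_or_ge k 0 with hk | hk
  · simp [elem_of_neg v m k hk]
  rcases lt_or_ge l 0 with hl | hl
  · simp [elem_of_neg v m l hl]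
  lift k to ℕ using hk
  lift l to ℕ using hl
  -- The two parameters are the variables of the iterated power series ring.
  let w : ℕ → PowerSeries (PowerSeries A) := fun i => C (C (v i))
  let t : PowerSeries (PowerSeries A) := C X
  let s : PowerSeries (PowerSeries A) := X
  have hw : SatisfiesB w := by
    constructor
    · intro a b hab
      simpa only [map_add, map_mul, map_pow] using
        congrArg (fun z => C (C z) : A → PowerSeries (PowerSeries A)) (hv.twoVar a b hab)
    · intro a b c hab hbc
      simpa only [map_mul] using
        congrArg (fun z => C (C z) : A → PowerSeries (PowerSeries A)) (hv.knuth₁ a b c hab hbc)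
    · intro a b c hab hbc
      simpa only [map_mul] using
        congrArg (fun z => C (C z) : A → PowerSeries (PowerSeries A)) (hv.knuth₂ a b c hab hbc)
  have ht : ∀ z, Commute t z := by
    intro z
    ext n : 1
    rw [coeff_C_mul, coeff_mul_C]
    exact (PowerSeries.commute_X _).symm.eq
  have hs : ∀ z, Commute s z := fun z => (PowerSeries.commute_X z).symm
  have htu : ∀ i, IsUnit (1 + t * w i) := by
    intro i
    have : IsUnit (1 + X * C (v i) : PowerSeries A) := by
      rw [PowerSeries.isUnit_iff_constantCoeff]; simp
    simpa [t, w] using this.map (C : PowerSeries A →+* PowerSeries (PowerSeries A))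
  have hsu : ∀ i, IsUnit (1 + s * w i) := by
    intro i
    rw [PowerSeries.isUnit_iff_constantCoeff]
    simp [s]
  have gen : ∀ m : ℕ, decProd (fun i => (1 + X * C (v i) : PowerSeries A)) 0 m =
      PowerSeries.mk fun k => elem v m k := by
    intro m
    induction m with
    | zero =>
      ext k
      simp [decProd, elem, coeff_one]
    | succ m ih =>
      ext k
      rw [decProd, ih, add_mul, one_mul, mul_assoc, map_add, coeff_mk, coeff_mk, elem, zero_add]
      congr 1
      cases k with
      | zero => simp [elem_of_neg]
      | succ k => rw [coeff_succ_X_mul, coeff_C_mul, coeff_mk]; simp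
  have genT : decProd (fun i => 1 + t * w i) 0 m = C (PowerSeries.mk fun k => elem v m k) := by
    rw [← gen]
    induction m with
    | zero => simp [decProd]
    | succ m ih => simp [decProd, ih, t, w]
  have genS : decProd (fun i => 1 + s * w i) 0 m = PowerSeries.mk fun k => C (elem v m k) := by
    have : decProd (fun i => 1 + s * w i) 0 m =
        PowerSeries.map (C : A →+* PowerSeries A) (PowerSeries.mk fun k => elem v m k) := by
      rw [← gen]
      clear genT
      induction m with
      | zero => simp [decProd]
      | succ m ih => simp [decProd, ih, s, w]
    rw [this]
    ext1 n
    simp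
  have key := decProd_mul_comm hw t s ht hs htu hsu m 0
  rw [genT, genS] at key
  have := congrArg (fun z => coeff k (coeff l z)) key
  simpa [coeff_C_mul, coeff_mul_C] using this

end Elem

/-- If all letters of `W` exceed `b`, then in the presence of `v b` on the left, `W` commutes with
the elementary symmetric functions of at most `b` letters. -/
theorem mul_elem_mul_prod {A : Type*} [Ring A] {v : ℕ → A} (hv : SatisfiesB v) (W : List ℕ)
    (b m : ℕ) (hmb : m ≤ b) (hW : (b :: W).Pairwise (· < ·)) (k : ℤ) :
    v b * elem v m k * (W.map v).prod = v b * (W.map v).prod * elem v m k := by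
  have one : ∀ m b c : ℕ, m ≤ b → b < c → ∀ k : ℤ,
      v b * elem v m k * v c = v b * v c * elem v m k := by
    intro m
    induction m with
    | zero => intro b c _ _ k; by_cases hk : k = 0 <;> simp [elem, hk]
    | succ m ih =>
      intro b c hmb hbc k
      have h2 := ih m c le_rfl (by omega) (k - 1)
      rw [elem, mul_add, add_mul, mul_add, ih b c (by omega) hbc k, mul_assoc (v b) _ (v c), h2,
        ← mul_assoc, ← mul_assoc, ← mul_assoc, ← hv.knuth₁ m b c (by omega) hbc]
  induction W generalizing b with
  | nil => simp
  | cons c W ih =>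
    rw [List.pairwise_cons] at hW
    have hbc : b < c := hW.1 c (by simp)
    rw [List.map_cons, List.prod_cons, ← mul_assoc, one m b c hmb hbc, mul_assoc, mul_assoc,
      ← mul_assoc (v c), ih c (by omega) hW.2]
    simp only [mul_assoc]

/-! ### Column determinants over a noncommutative ring -/

/-- The determinant of an `l × l` matrix over a noncommutative ring, where in each product the
columns are multiplied from left to right; `c j p` is the entry of column `j` in row `p`. -/
def ndet {A : Type*} [Ring A] (l : ℕ) (c : ℕ → ℕ → A) : A :=
  ∑ π : Equiv.Perm (Fin l),
    ((Equiv.Perm.sign π : ℤˣ) : ℤ) • (List.ofFn fun j : Fin l => c j (π j)).prod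

section Ndet

variable {A : Type*} [Ring A]

theorem prod_ofFn_congr_pair {l : ℕ} (f g : Fin l → A) (j : ℕ) (hj : j + 1 < l)
    (hfg : ∀ i : Fin l, (i : ℕ) ≠ j → (i : ℕ) ≠ j + 1 → f i = g i)
    (hp : f ⟨j, by omega⟩ * f ⟨j + 1, hj⟩ = g ⟨j, by omega⟩ * g ⟨j + 1, hj⟩) :
    (List.ofFn f).prod = (List.ofFn g).prod := by
  induction l generalizing j with
  | zero => omega
  | succ l ih =>
    cases j with
    | zero =>
      obtain ⟨l, rfl⟩ : ∃ k, l = k + 1 := ⟨l - 1, by omega⟩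
      simp only [List.ofFn_succ, List.prod_cons]
      rw [← mul_assoc, ← mul_assoc]
      congr 1
      congr 2
      funext i
      exact hfg _ (by simp) (by simp)
    | succ j =>
      simp only [List.ofFn_succ, List.prod_cons]
      rw [hfg 0 (by simp) (by simp)]
      congr 1
      refine ih _ _ j (by omega) (fun i h1 h2 => hfg _ ?_ ?_) ?_
      · simpa using h1
      · simpa using h2
      · simpa using hp

theorem ndet_congr {l : ℕ} {c c' : ℕ → ℕ → A} (h : ∀ j < l, ∀ p < l, c j p = c' j p) :
    ndet l c = ndet l c' := by
  unfold ndet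
  refine Finset.sum_congr rfl fun π _ => ?_
  congr 3
  funext j
  exact h _ j.2 _ (π j).2

/-- Two adjacent columns may be changed as long as their products do not change. -/
theorem ndet_congr_pair {l : ℕ} {c c' : ℕ → ℕ → A} (j : ℕ) (hj : j + 1 < l)
    (h : ∀ i, i ≠ j → i ≠ j + 1 → c i = c' i)
    (hp : ∀ p q, c j p * c (j + 1) q = c' j p * c' (j + 1) q) :
    ndet l c = ndet l c' := by
  unfold ndet
  refine Finset.sum_congr rfl fun π _ => ?_
  congr 1
  refine prod_ofFn_congr_pair _ _ j hj (fun i h1 h2 => ?_) (hp _ _)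
  rw [h _ h1 h2]

theorem ndet_eq_zero_of_pair {l : ℕ} {c : ℕ → ℕ → A} (j : ℕ) (hj : j + 1 < l)
    (hp : ∀ p q, c j p * c (j + 1) q = c j q * c (j + 1) p) : ndet l c = 0 := by
  unfold ndet
  have hne : (⟨j, by omega⟩ : Fin l) ≠ ⟨j + 1, hj⟩ := by simp
  refine Finset.sum_involution (fun π _ => π * Equiv.swap ⟨j, by omega⟩ ⟨j + 1, hj⟩) ?_ ?_
    (fun _ _ => Finset.mem_univ _) ?_
  · intro π _
    rw [Equiv.Perm.sign_mul, Equiv.Perm.sign_swap hne]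
    have : (List.ofFn fun i : Fin l => c i (π i)).prod =
        (List.ofFn fun i : Fin l =>
          c i ((π * Equiv.swap (⟨j, by omega⟩ : Fin l) ⟨j + 1, hj⟩ : Equiv.Perm (Fin l)) i)).prod := by
      refine prod_ofFn_congr_pair _ _ j hj (fun i h1 h2 => ?_) ?_
      · have h1' : i ≠ ⟨j, by omega⟩ := fun hc => h1 (by rw [hc])
        have h2' : i ≠ ⟨j + 1, hj⟩ := fun hc => h2 (by rw [hc])
        rw [Equiv.Perm.mul_apply, Equiv.swap_apply_of_ne_of_ne h1' h2']
      · simp only [Equiv.Perm.mul_apply, Equiv.swap_apply_left, Equiv.swap_apply_right]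
        exact hp _ _
    rw [this]
    simp
  · intro π _ _ hc
    have := congrArg (fun f => f ⟨j, by omega⟩) hc
    simp at this
  · intro π _
    rw [mul_assoc, Equiv.swap_mul_self, mul_one]

theorem ndet_update_add {l : ℕ} (c : ℕ → ℕ → A) (j : ℕ) (hj : j < l) (f g : ℕ → A) :
    ndet l (Function.update c j (f + g)) =
      ndet l (Function.update c j f) + ndet l (Function.update c j g) := by
  unfold ndet
  rw [← Finset.sum_add_distrib]
  refine Finset.sum_congr rfl fun π _ => ?_
  rw [← smul_add]
  congr 1
  have key : ∀ f : ℕ → A,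
      (List.ofFn fun i : Fin l => Function.update c j f i (π i)).prod =
        MultilinearMap.mkPiAlgebraFin ℤ l A
          (Function.update (fun i : Fin l => c i (π i)) ⟨j, hj⟩ (f (π ⟨j, hj⟩))) := by
    intro f
    rw [MultilinearMap.mkPiAlgebraFin_apply]
    congr 2
    funext i
    by_cases hi : (i : ℕ) = j
    · subst hi; simp
    · rw [Function.update_of_ne hi, Function.update_of_ne (fun hc => hi (by rw [hc]))]
  rw [key, key, key, ← MultilinearMap.map_update_add]
  rfl

theorem ndet_update_add_sum {l : ℕ} (c : ℕ → ℕ → A) (j : ℕ) (hj : j < l) (f : ℕ → A) {ι : Type*}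
    (s : Finset ι) (g : ι → ℕ → A) :
    ndet l (Function.update c j (f + ∑ x ∈ s, g x)) =
      ndet l (Function.update c j f) + ∑ x ∈ s, ndet l (Function.update c j (g x)) := by
  classical
  induction s using Finset.induction_on generalizing f with
  | empty => simp
  | insert a s ha ih =>
    rw [Finset.sum_insert ha, Finset.sum_insert ha, ← add_assoc, ih, ndet_update_add c j hj,
      add_assoc]

theorem ndet_mul_first {l : ℕ} (c : ℕ → ℕ → A) (hl : 0 < l) (w : A) :
    ndet l (Function.update c 0 fun p => w * c 0 p) = w * ndet l c := by
  obtain ⟨l, rfl⟩ : ∃ k, l = k + 1 := ⟨l - 1, by omega⟩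
  unfold ndet
  rw [Finset.mul_sum]
  refine Finset.sum_congr rfl fun π _ => ?_
  rw [mul_smul_comm]
  congr 1
  simp [List.ofFn_succ, mul_assoc]

theorem ndet_eq_zero_of_column {l : ℕ} (c : ℕ → ℕ → A) (j : ℕ) (hj : j < l)
    (h : ∀ p < l, c j p = 0) : ndet l c = 0 := by
  unfold ndet
  refine Finset.sum_eq_zero fun π _ => ?_
  rw [List.prod_eq_zero, smul_zero]
  rw [List.mem_ofFn]
  exact ⟨⟨j, hj⟩, h _ (π _).2⟩

/-- Suppose that only the rows `p = i` of the columns `i < j` and only the rows `p > j` of the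
columns `i > j` contribute.  Then only the entry of column `j` in row `j` matters. -/
theorem ndet_congr_column {l : ℕ} {c c' : ℕ → ℕ → A} (j : ℕ) (hj : j < l)
    (h : ∀ i, i ≠ j → c i = c' i)
    (h0 : ∀ i, i < j → ∀ p, p ≠ i → c i p = 0)
    (h1 : ∀ i, j < i → i < l → ∀ p, p ≤ j → c i p = 0)
    (hjj : c j j = c' j j) : ndet l c = ndet l c' := by
  unfold ndet
  refine Finset.sum_congr rfl fun π _ => ?_
  congr 1
  obtain ⟨i, hi⟩ := π.surjective ⟨j, hj⟩
  by_cases hij : (i : ℕ) = j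
  · congr 2
    funext k
    by_cases hk : (k : ℕ) = j
    · have : k = i := Fin.ext (hk.trans hij.symm)
      rw [this, hi, hij, hjj]
    · rw [h _ hk]
  · have hz : c i (π i) = 0 := by
      rw [hi]
      rcases lt_or_gt_of_ne hij with hlt | hgt
      · exact h0 _ hlt _ (fun hc => hij hc.symm)
      · exact h1 _ hgt i.2 _ le_rfl
    rw [List.prod_eq_zero, List.prod_eq_zero]
    · rw [List.mem_ofFn]
      exact ⟨i, by rw [← h _ hij, hz]⟩
    · rw [List.mem_ofFn]
      exact ⟨i, hz⟩

theorem ndet_one {l : ℕ} {c : ℕ → ℕ → A} (h : ∀ j < l, ∀ p < l, c j p = if p = j then 1 else 0) :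
    ndet l c = 1 := by
  unfold ndet
  rw [Finset.sum_eq_single 1]
  · rw [List.prod_eq_one]
    · simp
    · intro x hx
      rw [List.mem_ofFn] at hx
      obtain ⟨i, rfl⟩ := hx
      simp [h i i.2 i i.2]
  · intro π _ hπ
    obtain ⟨i, hi⟩ : ∃ i, π i ≠ i := by
      by_contra hc
      push Not at hc
      exact hπ (Equiv.ext hc)
    rw [List.prod_eq_zero, smul_zero]
    rw [List.mem_ofFn]
    refine ⟨i, ?_⟩
    rw [h i i.2 _ (π i).2, if_neg (fun hc => hi (Fin.ext hc))]
  · simp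

end Ndet

/-! ### Flagged tableaux -/

/-- The conditions defining `SSYT(α')ⁿ`, for fillings extended by `0` to all of `ℕ × ℕ`; here
`T j i` is the entry in column `j < l` and row `i < α j`. -/
structure IsTab (l : ℕ) (α n : ℕ → ℕ) (T : ℕ → ℕ → ℕ) : Prop where
  outside : ∀ j i, ¬(j < l ∧ i < α j) → T j i = 0
  row_weak : ∀ j k i, j < k → k < l → i < α j → i < α k → T j i ≤ T k i
  col_strict : ∀ j i i', j < l → i < i' → i' < α j → T j i < T j i'
  flag : ∀ j i, j < l → i < α j → T j i < n j
  bottom : ∀ j, j + 1 < l → α j < α (j + 1) → n j ≤ T (j + 1) (α (j + 1) - 1)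

/-- The filling obtained from `T` by putting `x` into row `i` of column `j`. -/
def setCell (T : ℕ → ℕ → ℕ) (j i x : ℕ) : ℕ → ℕ → ℕ :=
  Function.update T j (Function.update (T j) i x)

theorem setCell_self (T : ℕ → ℕ → ℕ) (j i x : ℕ) : setCell T j i x j i = x := by
  simp [setCell]

theorem setCell_of_col_ne (T : ℕ → ℕ → ℕ) {j k : ℕ} (i x : ℕ) (hk : k ≠ j) :
    setCell T j i x k = T k := by
  simp [setCell, hk]

theorem setCell_of_row_ne (T : ℕ → ℕ → ℕ) (j : ℕ) {i k : ℕ} (x : ℕ) (hk : k ≠ i) :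
    setCell T j i x j k = T j k := by
  simp [setCell, hk]

theorem setCell_setCell (T : ℕ → ℕ → ℕ) (j i x y : ℕ) :
    setCell (setCell T j i x) j i y = setCell T j i y := by
  simp [setCell]

theorem setCell_eq_self (T : ℕ → ℕ → ℕ) (j i x : ℕ) (h : T j i = x) : setCell T j i x = T := by
  subst h
  simp [setCell]

section Remove

variable {l : ℕ} {α n : ℕ → ℕ} {j a : ℕ}

/-- Removing the bottom cell of column `j` when column `j - 1` ends one row higher and column
`j + 1` is not longer: the removed entry `x` becomes the new flag of column `j`. -/
theorem IsTab.remove {T : ℕ → ℕ → ℕ} (hT : IsTab l α n T) (hj : j < l) (ha : α j = a + 1)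
    (hprev : ∀ i, i + 1 = j → α i = a) (hnext : j + 1 < l → α (j + 1) ≤ a + 1) :
    IsTab l (Function.update α j a) (Function.update n j (T j a)) (setCell T j a 0) := by
  have hne : ∀ k i, k < l → i < Function.update α j a k →
      i < α k ∧ setCell T j a 0 k i = T k i := by
    intro k i _ hi
    by_cases hk : k = j
    · subst hk
      rw [Function.update_self] at hi
      exact ⟨by omega, setCell_of_row_ne _ _ _ hi.ne⟩
    · rw [Function.update_of_ne hk] at hi
      exact ⟨hi, by rw [setCell_of_col_ne _ _ _ hk]⟩
  constructor
  · intro k i hki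
    by_cases hk : k = j
    · subst hk
      by_cases hi : i = a
      · rw [hi, setCell_self]
      · rw [setCell_of_row_ne _ _ _ hi]
        rw [Function.update_self] at hki
        exact hT.outside _ _ (by omega)
    · rw [Function.update_of_ne hk] at hki
      rw [setCell_of_col_ne _ _ _ hk, hT.outside _ _ hki]
  · intro k k' i hkk' hk' hi hi'
    obtain ⟨h1, h2⟩ := hne k i (by omega) hi
    obtain ⟨h3, h4⟩ := hne k' i hk' hi'
    rw [h2, h4]
    exact hT.row_weak k k' i hkk' hk' h1 h3
  · intro k i i' hk hii' hi'
    obtain ⟨h1, h2⟩ := hne k i hk (by omega)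
    obtain ⟨h3, h4⟩ := hne k i' hk hi'
    rw [h2, h4]
    exact hT.col_strict k i i' hk hii' h3
  · intro k i hk hi
    obtain ⟨h1, h2⟩ := hne k i hk hi
    rw [h2]
    by_cases hkj : k = j
    · subst hkj
      rw [Function.update_self] at hi ⊢
      exact hT.col_strict k i a hk hi (by omega)
    · rw [Function.update_of_ne hkj]
      exact hT.flag k i hk h1
  · intro k hk hlt
    by_cases hkj : k = j
    · subst hkj
      rw [Function.update_self, Function.update_of_ne (by omega)] at hlt
      rw [Function.update_self, Function.update_of_ne (by omega), setCell_of_col_ne _ _ _ (by omega)]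
      have : α (k + 1) = a + 1 := by have := hnext hk; omega
      rw [this, Nat.add_sub_cancel]
      exact hT.row_weak k (k + 1) a (by omega) hk (by omega) (by omega)
    · by_cases hkj' : k + 1 = j
      · subst hkj'
        rw [Function.update_self, Function.update_of_ne hkj, hprev k rfl] at hlt
        omega
      · rw [Function.update_of_ne hkj, Function.update_of_ne hkj'] at hlt
        rw [Function.update_of_ne hkj, Function.update_of_ne hkj', setCell_of_col_ne _ _ _ hkj']
        exact hT.bottom k hk hlt

/-- The inverse of `IsTab.remove`. -/
theorem IsTab.insert {T : ℕ → ℕ → ℕ} {x : ℕ} (hj : j < l) (ha : α j = a + 1)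
    (hT : IsTab l (Function.update α j a) (Function.update n j x) T)
    (hprev : ∀ i, i + 1 = j → α i = a ∧ n i ≤ x) (hnext : j + 1 < l → α (j + 1) ≤ a + 1)
    (hx : x < n j) (hα : ∀ i, i + 1 < l → α (i + 1) ≤ α i + 1)
    (hn : ∀ i k, i ≤ k → k < l → n i ≤ n k) :
    IsTab l α n (setCell T j a x) := by
  have hne : ∀ k i, k < l → i < α k → (k = j ∧ i = a ∧ setCell T j a x k i = x) ∨
      (i < Function.update α j a k ∧ setCell T j a x k i = T k i ∧ (k = j → i < a)) := by
    intro k i _ hi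
    by_cases hk : k = j
    · subst hk
      by_cases hia : i = a
      · left
        exact ⟨rfl, hia, by rw [hia, setCell_self]⟩
      · right
        rw [Function.update_self]
        exact ⟨by omega, setCell_of_row_ne _ _ _ hia, fun _ => by omega⟩
    · right
      rw [Function.update_of_ne hk]
      exact ⟨hi, by rw [setCell_of_col_ne _ _ _ hk], fun h => absurd h hk⟩
  -- Row `a` to the right of column `j`: either the row is filled without gaps from column `j + 1`
  -- on, or the flag at the last gap applies.
  have hright : ∀ k, j < k → k < l → a < α k → x ≤ T k a := by
    intro k hjk
    induction k, hjk using Nat.le_induction with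
    | base =>
      intro hk hak
      have hb := hT.bottom j hk
      rw [Function.update_self, Function.update_self, Function.update_of_ne (by omega)] at hb
      have hak' : a < α (j + 1) := hak
      have h1 : α (j + 1) - 1 = a := by have := hnext hk; omega
      rw [h1] at hb
      exact hb hak'
    | succ k hjk ih =>
      intro hk hak
      have hkj : k ≠ j := by omega
      have hkj' : k + 1 ≠ j := by omega
      rcases lt_or_ge a (α k) with hc | hc
      · refine (ih (by omega) hc).trans (hT.row_weak k (k + 1) a (by omega) hk ?_ ?_)
        · rwa [Function.update_of_ne hkj]
        · rwa [Function.update_of_ne hkj']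
      · have hb := hT.bottom k hk
        rw [Function.update_of_ne hkj, Function.update_of_ne hkj, Function.update_of_ne hkj'] at hb
        have h1 : α (k + 1) - 1 = a := by have := hα k hk; omega
        rw [h1] at hb
        have := hb (by omega)
        have := hn j k (by omega) (by omega)
        omega
  constructor
  · intro k i hki
    by_cases hk : k = j
    · subst hk
      have hi : i ≠ a := by rintro rfl; omega
      rw [setCell_of_row_ne _ _ _ hi]
      refine hT.outside _ _ ?_
      rw [Function.update_self]
      omega
    · rw [setCell_of_col_ne _ _ _ hk]
      refine hT.outside _ _ ?_
      rwa [Function.update_of_ne hk]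
  · intro k k' i hkk' hk' hi hi'
    rcases hne k i (by omega) hi with ⟨h1, h2, h3⟩ | ⟨h1, h2, -⟩ <;>
      rcases hne k' i hk' hi' with ⟨h4, h5, h6⟩ | ⟨h4, h5, -⟩
    · omega
    · rw [h3, h5, h2]
      exact hright k' (by omega) hk' (by omega)
    · rw [h2, h6]
      obtain ⟨j', rfl⟩ : ∃ j', j = j' + 1 := ⟨j - 1, by omega⟩
      obtain ⟨h7, h8⟩ := hprev j' rfl
      have hkj' : k ≠ j' := by rintro rfl; omega
      have := hT.flag k i (by omega) h1
      rw [Function.update_of_ne (by omega)] at this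
      have := hn k j' (by omega) (by omega)
      omega
    · rw [h2, h5]
      exact hT.row_weak k k' i hkk' hk' h1 h4
  · intro k i i' hk hii' hi'
    rcases hne k i hk (by omega) with ⟨h1, h2, h3⟩ | ⟨h1, h2, h2'⟩ <;>
      rcases hne k i' hk hi' with ⟨h4, h5, h6⟩ | ⟨h4, h5, h5'⟩
    · omega
    · have := h5' h1
      omega
    · rw [h2, h6]
      have := hT.flag k i hk h1
      rwa [h4, Function.update_self, ← h4] at this
    · rw [h2, h5]
      exact hT.col_strict k i i' hk hii' h4
  · intro k i hk hi
    rcases hne k i hk hi with ⟨h1, h2, h3⟩ | ⟨h1, h2, -⟩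
    · rw [h3, h1]
      exact hx
    · rw [h2]
      have := hT.flag k i hk h1
      by_cases hkj : k = j
      · rw [hkj, Function.update_self] at this
        rw [hkj]
        omega
      · rwa [Function.update_of_ne hkj] at this
  · intro k hk hlt
    by_cases hkj : k = j
    · subst hkj
      have := hnext hk
      omega
    · by_cases hkj' : k + 1 = j
      · subst hkj'
        rw [ha, Nat.add_sub_cancel, setCell_self]
        exact (hprev k rfl).2
      · have := hT.bottom k hk
        rw [Function.update_of_ne hkj, Function.update_of_ne hkj, Function.update_of_ne hkj'] at this
        rw [setCell_of_col_ne _ _ _ hkj']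
        exact this hlt

end Remove

/-- The `d`-th diagonal of `T` in the sense of `diagread`: column `j` contributes the cell in row
`j + R - d`. -/
def diagList (l R : ℕ) (α : ℕ → ℕ) (T : ℕ → ℕ → ℕ) (d : ℕ) : List ℕ :=
  (List.range l).filterMap fun j =>
    if d ≤ j + R ∧ j + R - d < α j then some (T j (j + R - d)) else none

theorem diagList_eq_nil {l R d : ℕ} {α : ℕ → ℕ} (T : ℕ → ℕ → ℕ)
    (h : ∀ j < l, α j + d ≤ j + R ∨ α j = 0) : diagList l R α T d = [] := by
  unfold diagList
  rw [List.filterMap_eq_nil_iff]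
  intro j hj
  rw [if_neg]
  have := h j (List.mem_range.1 hj)
  omega

/-- If column `j` ends on diagonal `d` and the columns to its right do not meet this diagonal, then
the bottom cell of column `j` is the last one of the diagonal. -/
theorem diagList_setCell_self {l R d j a x : ℕ} {α : ℕ → ℕ} (T : ℕ → ℕ → ℕ) (hj : j < l)
    (ha : α j = a + 1) (had : a + d = j + R)
    (hright : ∀ i, j < i → i < l → α i + d ≤ i + R ∨ α i = 0) :
    diagList l R α (setCell T j a x) d = diagList l R (Function.update α j a) T d ++ [x] := by
  have split : List.range l = List.range j ++ (j :: (List.range' (j + 1) (l - (j + 1)))) := by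
    have := List.range'_append_1 (s := 0) (m := j) (n := l - (j + 1) + 1)
    rw [zero_add, show j + (l - (j + 1) + 1) = l by omega, List.range'_succ] at this
    rw [List.range_eq_range', List.range_eq_range', this]
  unfold diagList
  rw [split, List.filterMap_append, List.filterMap_append, List.filterMap_cons,
    List.filterMap_cons, if_pos ⟨by omega, by omega⟩, if_neg (by rw [Function.update_self]; omega)]
  have h1 : ∀ (β : ℕ → ℕ) (S : ℕ → ℕ → ℕ), (∀ i, j < i → β i = α i) →
      (List.range' (j + 1) (l - (j + 1))).filterMap (fun j =>
        if d ≤ j + R ∧ j + R - d < β j then some (S j (j + R - d)) else none) = [] := by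
    intro β S hβ
    rw [List.filterMap_eq_nil_iff]
    intro i hi
    rw [List.mem_range'_1] at hi
    rw [if_neg]
    rw [hβ i (by omega)]
    have := hright i (by omega) (by omega)
    omega
  rw [h1 α _ (fun _ _ => rfl), h1 _ T (fun i hi => by rw [Function.update_of_ne hi.ne'])]
  have : j + R - d = a := by omega
  rw [this, setCell_self, List.append_nil]
  congr 1
  refine List.filterMap_congr fun i hi => ?_
  have hij : i ≠ j := (List.mem_range.1 hi).ne
  rw [Function.update_of_ne hij, setCell_of_col_ne _ _ _ hij]

theorem diagList_setCell_of_lt {l R d e j a x : ℕ} {α : ℕ → ℕ} (T : ℕ → ℕ → ℕ)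
    (ha : α j = a + 1) (had : a + d = j + R) (hde : d < e) :
    diagList l R α (setCell T j a x) e = diagList l R (Function.update α j a) T e := by
  unfold diagList
  refine List.filterMap_congr fun i _ => ?_
  by_cases hij : i = j
  · subst hij
    rw [Function.update_self]
    by_cases hc : e ≤ i + R ∧ i + R - e < a
    · rw [if_pos hc, if_pos ⟨hc.1, by omega⟩, setCell_of_row_ne _ _ _ hc.2.ne]
    · rw [if_neg hc, if_neg (by omega)]
  · rw [Function.update_of_ne hij, setCell_of_col_ne _ _ _ hij]

/-! ### The expansion of column-flagged Schur functions -/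

section Expansion

variable {A : Type*} [Ring A]

/-- The columns of the matrix whose determinant is the column-flagged Schur function `J_α(n)`. -/
def flagCol (v : ℕ → A) (α n : ℕ → ℕ) (j p : ℕ) : A :=
  elem v (n j) ((α j : ℤ) + p - j)

/-- The word `w` inserted to the left of column `j`. -/
def insertAt (j : ℕ) (w : A) (c : ℕ → ℕ → A) : ℕ → ℕ → A :=
  Function.update c j fun p => w * c j p

theorem insertAt_one (j : ℕ) (c : ℕ → ℕ → A) : insertAt j 1 c = c := by
  simp [insertAt]

/-- A word inserted between columns `j` and `j + 1` can be absorbed in either of them. -/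
theorem ndet_insertAt_succ {l j : ℕ} (w : A) (c : ℕ → ℕ → A) (hw : w = 1 ∨ j + 1 < l) :
    ndet l (insertAt (j + 1) w c) = ndet l (Function.update c j fun p => c j p * w) := by
  rcases hw with rfl | hj
  · rw [insertAt_one]
    simp
  · refine ndet_congr_pair j hj (fun i h1 h2 => ?_) fun p q => ?_
    · rw [insertAt, Function.update_of_ne h2, Function.update_of_ne h1]
    · rw [insertAt, Function.update_self, Function.update_self, Function.update_of_ne (by omega),
        Function.update_of_ne (by omega), mul_assoc]

/-- The state of the expansion of `J_α(n)` when the diagonals before diagonal `d` (in the numbering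
of `diagread`) have been removed completely, and diagonal `d` has been removed from the columns
`j, j + 1, …`; the letters removed from diagonal `d` form the word `W`, which stands between the
columns `j - 1` and `j`.  Columns `i` with `i + R < d` no longer have any role and get flag `0`. -/
structure IsState (l R d j : ℕ) (α n : ℕ → ℕ) (W : List ℕ) : Prop where
  growth : ∀ i, i + 1 < l → α (i + 1) ≤ α i + 1
  mono : ∀ i k, i ≤ k → k < l → n i ≤ n k
  left : ∀ i, i < j → i < l → α i + d ≤ i + R + 1 ∨ (α i = 0 ∧ n i = 0)
  right : ∀ i, j ≤ i → i < l → α i + d ≤ i + R ∨ (α i = 0 ∧ n i = 0)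
  sorted : W.Pairwise (· < ·)
  large : ∀ c ∈ W, ∀ i, i < j → n i ≤ c
  chain : W = [] ∨ (j < l ∧ ∀ i, i < j → i + R < α i + d)

/-- The word of the letters of the diagonals `d, …, d + f - 1` of `T`. -/
def diagWord (v : ℕ → A) (l R : ℕ) (α : ℕ → ℕ) (T : ℕ → ℕ → ℕ) (d f : ℕ) : A :=
  (((List.range' d f).flatMap (diagList l R α T)).map v).prod

theorem diagWord_succ (v : ℕ → A) (l R : ℕ) (α : ℕ → ℕ) (T : ℕ → ℕ → ℕ) (d f : ℕ) :
    diagWord v l R α T d (f + 1) =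
      ((diagList l R α T d).map v).prod * diagWord v l R α T (d + 1) f := by
  simp [diagWord, List.range'_succ]

theorem diagWord_setCell {l R d e f j a x : ℕ} {α : ℕ → ℕ} (v : ℕ → A) (T : ℕ → ℕ → ℕ)
    (ha : α j = a + 1) (had : a + d = j + R) (hde : d < e) :
    diagWord v l R α (setCell T j a x) e f = diagWord v l R (Function.update α j a) T e f := by
  unfold diagWord
  congr 2
  rw [List.flatMap_def, List.flatMap_def]
  congr 1
  refine List.map_congr_left fun k hk => ?_
  rw [List.mem_range'_1] at hk
  exact diagList_setCell_of_lt T ha had (by omega)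

/-- `X` is the sum of the terms `f T` over the flagged tableaux `T`. -/
def IsTabSum (l : ℕ) (α n : ℕ → ℕ) (X : A) (f : (ℕ → ℕ → ℕ) → A) : Prop :=
  ∃ 𝒯 : Finset (ℕ → ℕ → ℕ), (∀ T, T ∈ 𝒯 ↔ IsTab l α n T) ∧ X = ∑ T ∈ 𝒯, f T

/-- Sorting the flagged tableaux by the bottom entry of column `j`. -/
theorem isTabSum_of_remove {l : ℕ} {α n : ℕ → ℕ} {j a m : ℕ} (hj : j < l) (ha : α j = a + 1)
    (hprev : ∀ i, i + 1 = j → α i = a ∧ n i = m) (hm : j = 0 → m = 0)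
    (hnext : j + 1 < l → α (j + 1) ≤ a + 1) (hα : ∀ i, i + 1 < l → α (i + 1) ≤ α i + 1)
    (hn : ∀ i k, i ≤ k → k < l → n i ≤ n k) (X : ℕ → A) (f : (ℕ → ℕ → ℕ) → A)
    (hX : ∀ x, m ≤ x → x < n j →
      IsTabSum l (Function.update α j a) (Function.update n j x) (X x)
        fun T => f (setCell T j a x)) :
    IsTabSum l α n (∑ x ∈ Finset.Ico m (n j), X x) f := by
  classical
  have hX' : ∀ x, ∃ 𝒯 : Finset (ℕ → ℕ → ℕ), x ∈ Finset.Ico m (n j) →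
      (∀ T, T ∈ 𝒯 ↔ IsTab l (Function.update α j a) (Function.update n j x) T) ∧
        X x = ∑ T ∈ 𝒯, f (setCell T j a x) := by
    intro x
    by_cases hx : x ∈ Finset.Ico m (n j)
    · rw [Finset.mem_Ico] at hx
      obtain ⟨𝒯, h⟩ := hX x hx.1 hx.2
      exact ⟨𝒯, fun _ => h⟩
    · exact ⟨∅, fun h => absurd h hx⟩
  choose 𝒯 h𝒯 using hX'
  refine ⟨(Finset.Ico m (n j)).biUnion fun x => (𝒯 x).image fun T => setCell T j a x, ?_, ?_⟩
  · intro T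
    simp only [Finset.mem_biUnion, Finset.mem_image]
    constructor
    · rintro ⟨x, hx, S, hS, rfl⟩
      rw [(h𝒯 x hx).1] at hS
      rw [Finset.mem_Ico] at hx
      exact hS.insert hj ha (fun i hi => ⟨(hprev i hi).1, (hprev i hi).2.trans_le hx.1⟩) hnext hx.2
        hα hn
    · intro hT
      have hx : T j a ∈ Finset.Ico m (n j) := by
        rw [Finset.mem_Ico]
        refine ⟨?_, hT.flag j a hj (by omega)⟩
        rcases Nat.eq_zero_or_pos j with h0 | h0
        · rw [hm h0]; exact Nat.zero_le _
        · obtain ⟨i, rfl⟩ : ∃ i, j = i + 1 := ⟨j - 1, by omega⟩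
          obtain ⟨h1, h2⟩ := hprev i rfl
          have := hT.bottom i hj (by omega)
          rwa [ha, h2, Nat.add_sub_cancel] at this
      refine ⟨T j a, hx, setCell T j a 0, ?_, ?_⟩
      · rw [(h𝒯 _ hx).1]
        exact hT.remove hj ha (fun i hi => (hprev i hi).1) hnext
      · rw [setCell_setCell, setCell_eq_self _ _ _ _ rfl]
  · rw [Finset.sum_biUnion]
    · refine Finset.sum_congr rfl fun x hx => ?_
      rw [(h𝒯 x hx).2, Finset.sum_image]
      intro S hS S' hS' hSS'
      have key : ∀ S ∈ 𝒯 x, setCell (setCell S j a x) j a 0 = S := by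
        intro S hS
        rw [(h𝒯 x hx).1] at hS
        rw [setCell_setCell, setCell_eq_self]
        refine hS.outside j a ?_
        rw [Function.update_self]
        omega
      rw [← key S hS, ← key S' hS']
      exact congrArg (fun T => setCell T j a 0) hSS'
    · intro x _ y _ hxy
      rw [Function.onFun, Finset.disjoint_left]
      intro T hT hT'
      rw [Finset.mem_image] at hT hT'
      obtain ⟨S, _, rfl⟩ := hT
      obtain ⟨S', _, h⟩ := hT'
      have := congrFun (congrFun h j) a
      rw [setCell_self, setCell_self] at this
      exact hxy this.symm

theorem isTab_update_flag_iff {l : ℕ} {α n : ℕ → ℕ} {j : ℕ} (y : ℕ) (h0 : α j = 0)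
    (h1 : j + 1 < l → α (j + 1) = 0) (T : ℕ → ℕ → ℕ) :
    IsTab l α (Function.update n j y) T ↔ IsTab l α n T := by
  have hflag : ∀ k i, i < α k → Function.update n j y k = n k := by
    intro k i hi
    rw [Function.update_of_ne]
    rintro rfl
    omega
  have hbot : ∀ k, k + 1 < l → α k < α (k + 1) → Function.update n j y k = n k := by
    intro k hk hlt
    rw [Function.update_of_ne]
    rintro rfl
    have := h1 hk
    omega
  constructor
  · rintro ⟨a, b, c, d, e⟩
    exact ⟨a, b, c, fun k i hk hi => hflag k i hi ▸ d k i hk hi,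
      fun k hk hlt => hbot k hk hlt ▸ e k hk hlt⟩
  · rintro ⟨a, b, c, d, e⟩
    exact ⟨a, b, c, fun k i hk hi => (hflag k i hi).symm ▸ d k i hk hi,
      fun k hk hlt => (hbot k hk hlt).symm ▸ e k hk hlt⟩

variable {v : ℕ → A}

/-- Expanding column `j`, when column `j - 1` ends one row higher: the letters below the flag of
column `j - 1` contribute nothing, since they give a determinant with two commuting columns. -/
theorem ndet_expand_column (hv : SatisfiesB v) {l j m a : ℕ} {α n : ℕ → ℕ} {W : List ℕ}
    (hj : j < l) (ha : α j = a + 1) (hprev : ∀ i, i + 1 = j → α i = a ∧ n i = m)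
    (hm : j = 0 → m = 0) (hmn : m ≤ n j) (hW : W = [] ∨ j + 1 < l)
    (hWs : W.Pairwise (· < ·)) (hWl : ∀ c ∈ W, n j ≤ c) :
    ndet l (insertAt (j + 1) (W.map v).prod (flagCol v α n)) =
      ∑ x ∈ Finset.Ico m (n j), ndet l (insertAt j ((x :: W).map v).prod
        (flagCol v (Function.update α j a) (Function.update n j x))) := by
  set w := (W.map v).prod with hw
  have hw1 : w = 1 ∨ j + 1 < l := hW.imp (fun h => by rw [hw, h]; rfl) id
  have hcol : (fun p => flagCol v α n j p * w) =
      (fun p : ℕ => elem v m ((α j : ℤ) + p - j) * w) +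
        ∑ x ∈ Finset.Ico m (n j), fun p : ℕ => v x * w * elem v x ((a : ℤ) + p - j) := by
    funext p
    rw [Pi.add_apply, Finset.sum_apply, flagCol, elem_eq_add_sum v m (n j) hmn, add_mul,
      Finset.sum_mul]
    congr 1
    refine Finset.sum_congr rfl fun x hx => ?_
    rw [Finset.mem_Ico] at hx
    rw [mul_elem_mul_prod hv W x x le_rfl]
    · congr 2
      rw [ha]
      push_cast
      ring
    · rw [List.pairwise_cons]
      exact ⟨fun c hc => hx.2.trans_le (hWl c hc), hWs⟩
  rw [ndet_insertAt_succ w _ hw1, hcol, ndet_update_add_sum _ j hj]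
  have hzero : ndet l (Function.update (flagCol v α n) j
      fun p : ℕ => elem v m ((α j : ℤ) + p - j) * w) = 0 := by
    rcases Nat.eq_zero_or_pos j with h0 | h0
    · refine ndet_eq_zero_of_column _ j hj fun p _ => ?_
      rw [Function.update_self, hm h0, elem, if_neg (by rw [ha, h0]; push_cast; omega), zero_mul]
    · obtain ⟨i, rfl⟩ : ∃ i, j = i + 1 := ⟨j - 1, by omega⟩
      obtain ⟨h1, h2⟩ := hprev i rfl
      refine ndet_eq_zero_of_pair i hj fun p q => ?_
      rw [Function.update_self, Function.update_of_ne (by omega), flagCol, flagCol, h2, ← mul_assoc,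
        ← mul_assoc, h1, ha]
      have : ∀ p : ℕ, ((a + 1 : ℕ) : ℤ) + p - ((i + 1 : ℕ) : ℤ) = (a : ℤ) + p - i := by
        intro p; push_cast; ring
      rw [this, this, elem_mul_comm hv]
  rw [hzero, zero_add]
  refine Finset.sum_congr rfl fun x _ => ?_
  congr 1
  funext k
  by_cases hk : k = j
  · subst hk
    rw [insertAt, Function.update_self, Function.update_self]
    funext p
    rw [flagCol, Function.update_self, Function.update_self, List.map_cons, List.prod_cons]
  · rw [insertAt, Function.update_of_ne hk, Function.update_of_ne hk]
    funext p
    rw [flagCol, flagCol, Function.update_of_ne hk, Function.update_of_ne hk]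

/-- A column without cells and all columns to its left may be given the flag `0`, and then letters
can be moved across it. -/
theorem ndet_skip_column {l j : ℕ} {α n : ℕ → ℕ} {w : A} (hj : j < l) (hw : w = 1 ∨ j + 1 < l)
    (hα : ∀ i ≤ j, α i = 0) (hn : ∀ i < j, n i = 0)
    (hright : ∀ i, j < i → i < l → α i + j + 1 ≤ i ∨ α i = 0) :
    ndet l (insertAt (j + 1) w (flagCol v α n)) =
      ndet l (insertAt j w (flagCol v α (Function.update n j 0))) := by
  have hne : ∀ i, i ≠ j → flagCol v α n i = flagCol v α (Function.update n j 0) i := by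
    intro i hi
    funext p
    rw [flagCol, flagCol, Function.update_of_ne hi]
  have h1 : ndet l (insertAt (j + 1) w (flagCol v α n)) =
      ndet l (insertAt (j + 1) w (flagCol v α (Function.update n j 0))) := by
    refine ndet_congr_column j hj (fun i hi => ?_) (fun i hi p hp => ?_) (fun i hi hil p hp => ?_) ?_
    · by_cases hij : i = j + 1
      · subst hij
        rw [insertAt, insertAt, Function.update_self, Function.update_self, hne _ hi]
      · rw [insertAt, insertAt, Function.update_of_ne hij, Function.update_of_ne hij, hne _ hi]
    · rw [insertAt, Function.update_of_ne (by omega), flagCol, hn i hi, hα i hi.le, elem, if_neg]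
      omega
    · have hz : flagCol v α n i p = 0 := by
        rw [flagCol, elem_of_neg]
        have := hright i hi hil
        omega
      by_cases hij : i = j + 1
      · subst hij
        rw [insertAt, Function.update_self]
        rw [hz, mul_zero]
      · rw [insertAt, Function.update_of_ne hij, hz]
    · rw [insertAt, insertAt, Function.update_of_ne (by omega), Function.update_of_ne (by omega),
        flagCol, flagCol, hα j le_rfl, Function.update_self]
      simp [elem_zero_right]
  rw [h1, ndet_insertAt_succ w _ hw]
  congr 1
  rw [insertAt]
  congr 1
  funext p
  rw [flagCol, Function.update_self, elem]
  split_ifs <;> simp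

/-- Removing one diagonal, column by column from right to left. -/
theorem isTabSum_of_isState (hv : SatisfiesB v) {l R d f : ℕ}
    (ih : ∀ α n, IsState l R (d + 1) l α n [] →
      IsTabSum l α n (ndet l (flagCol v α n)) fun T => diagWord v l R α T (d + 1) f)
    (j : ℕ) (hj : j ≤ l) (α n : ℕ → ℕ) (W : List ℕ) (hS : IsState l R d j α n W) :
    IsTabSum l α n (ndet l (insertAt j (W.map v).prod (flagCol v α n))) fun T =>
      ((diagList l R α T d).map v).prod * (W.map v).prod * diagWord v l R α T (d + 1) f := by
  induction j generalizing α n W with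
  | zero =>
    have hR := hS.right
    have h1 : ndet l (insertAt 0 (W.map v).prod (flagCol v α n)) =
        (W.map v).prod * ndet l (flagCol v α n) := by
      rcases hS.chain with rfl | ⟨h0, _⟩
      · rw [List.map_nil, List.prod_nil, insertAt_one, one_mul]
      · exact ndet_mul_first _ h0 _
    obtain ⟨𝒯, h𝒯, hsum⟩ := ih α n ⟨hS.growth, hS.mono, fun i _ hil => by
      have := hR i (Nat.zero_le _) hil
      omega, fun i hi hil => by omega, List.Pairwise.nil, by simp, Or.inl rfl⟩
    refine ⟨𝒯, h𝒯, ?_⟩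
    rw [h1, hsum, Finset.mul_sum]
    refine Finset.sum_congr rfl fun T _ => ?_
    beta_reduce
    rw [diagList_eq_nil T fun i hi => (hR i (Nat.zero_le _) hi).imp id And.left]
    simp
  | succ j ihj =>
    have hw1 : (W.map v).prod = 1 ∨ j + 1 < l :=
      hS.chain.imp (fun h => by rw [h]; rfl) And.left
    rcases le_or_gt (α j + d) (j + R) with hd | hd
    · -- Column `j` does not meet the diagonal.
      have hW : W = [] := by
        refine hS.chain.resolve_right fun h => ?_
        have := h.2 j (by omega)
        omega
      subst hW
      have h1 := ihj (by omega) α n [] ⟨hS.growth, hS.mono, fun i hi => hS.left i (by omega),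
        fun i hi hil => by
          rcases eq_or_lt_of_le hi with rfl | hi
          · exact Or.inl hd
          · exact hS.right i hi hil, List.Pairwise.nil, by simp, Or.inl rfl⟩
      rw [List.map_nil, List.prod_nil, insertAt_one] at h1 ⊢
      exact h1
    rcases Nat.eq_zero_or_pos (α j) with h0 | hpos
    · -- Column `j` has no cells left.
      have hleft : ∀ i ≤ j, α i = 0 ∧ (i < j → n i = 0) := by
        intro i hi
        have := hS.left i (by omega) (by omega)
        omega
      have hright : ∀ i, j < i → i < l → α i + j + 1 ≤ i ∨ α i = 0 := by
        intro i hi hil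
        have := hS.right i hi hil
        omega
      have hnext : j + 1 < l → α (j + 1) = 0 := by
        intro h
        have := hright (j + 1) (by omega) h
        omega
      rw [ndet_skip_column (by omega) hw1 (fun i hi => (hleft i hi).1)
        (fun i hi => (hleft i hi.le).2 hi) hright]
      have hle : ∀ i, Function.update n j 0 i ≤ n i := by
        intro i
        by_cases hi : i = j
        · rw [hi, Function.update_self]; exact Nat.zero_le _
        · rw [Function.update_of_ne hi]
      obtain ⟨𝒯, h𝒯, hsum⟩ := ihj (by omega) α (Function.update n j 0) W
        ⟨hS.growth, fun i k hik hk => by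
            rcases le_or_gt i j with hi | hi
            · have : Function.update n j 0 i = 0 := by
                rcases eq_or_lt_of_le hi with rfl | hi
                · rw [Function.update_self]
                · rw [Function.update_of_ne hi.ne, (hleft i hi.le).2 hi]
              rw [this]; exact Nat.zero_le _
            · rw [Function.update_of_ne (by omega), Function.update_of_ne (by omega)]
              exact hS.mono i k hik hk,
          fun i hi hil => by
            rw [Function.update_of_ne hi.ne]
            exact hS.left i (by omega) hil,
          fun i hi hil => by
            rcases eq_or_lt_of_le hi with rfl | hi
            · exact Or.inr ⟨h0, Function.update_self ..⟩
            · rw [Function.update_of_ne hi.ne']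
              exact hS.right i hi hil,
          hS.sorted, fun c hc i hi => (hle i).trans (hS.large c hc i (by omega)),
          hS.chain.imp id fun h => ⟨by omega, fun i hi => h.2 i (by omega)⟩⟩
      exact ⟨𝒯, fun T => (h𝒯 T).trans (isTab_update_flag_iff 0 h0 hnext T), hsum⟩
    · -- The bottom cell of column `j` is on the diagonal.
      obtain ⟨a, ha⟩ : ∃ a, α j = a + 1 := ⟨α j - 1, by omega⟩
      have had : a + d = j + R := by
        have := hS.left j (by omega) (by omega)
        omega
      set m := if j = 0 then 0 else n (j - 1) with hm
      have hm0 : j = 0 → m = 0 := fun h => by rw [hm, if_pos h]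
      have hprev : ∀ i, i + 1 = j → α i = a ∧ n i = m := by
        rintro i rfl
        refine ⟨?_, ?_⟩
        · have h1 := hS.growth i (by omega)
          have h2 := hS.left i (by omega) (by omega)
          omega
        · rw [hm, if_neg (by omega), Nat.add_sub_cancel]
      have hmle : m ≤ n j := by
        rw [hm]
        split_ifs with h
        · exact Nat.zero_le _
        · exact hS.mono _ _ (by omega) (by omega)
      have hnext : j + 1 < l → α (j + 1) ≤ a + 1 := by
        intro h
        have := hS.right (j + 1) le_rfl h
        omega
      have hgrow : ∀ k i, i + k = j → α j ≤ α i + k := by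
        intro k
        induction k with
        | zero => rintro i rfl; exact le_rfl
        | succ k ihk =>
          intro i hi
          have h1 := ihk (i + 1) (by omega)
          have h2 := hS.growth i (by omega)
          omega
      rw [ndet_expand_column hv (by omega) ha hprev hm0 hmle (hS.chain.imp id And.left) hS.sorted
        fun c hc => hS.large c hc j (by omega)]
      refine isTabSum_of_remove (by omega) ha hprev hm0 hnext
        hS.growth hS.mono _ _ fun x hmx hxn => ?_
      have hbefore : ∀ i < j, n i ≤ x := by
        intro i hi
        refine le_trans (hS.mono i (j - 1) (by omega) (by omega)) ?_
        rwa [hm, if_neg (by omega)] at hmx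
      have hright : ∀ i, j < i → i < l → α i + d ≤ i + R ∨ α i = 0 := fun i hi hil =>
        (hS.right i hi hil).imp id And.left
      obtain ⟨𝒯, h𝒯, hsum⟩ := ihj (by omega) (Function.update α j a) (Function.update n j x) (x :: W)
        ⟨fun i hi => by
            by_cases h1 : i = j
            · subst h1
              rw [Function.update_self, Function.update_of_ne (by omega)]
              exact hnext hi
            · rw [Function.update_of_ne h1]
              by_cases h2 : i + 1 = j
              · subst h2
                rw [Function.update_self, (hprev i rfl).1]
                exact Nat.le_succ _
              · rw [Function.update_of_ne h2]
                exact hS.growth i hi,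
          fun i k hik hk => by
            by_cases h1 : i = j
            · subst h1
              rw [Function.update_self]
              by_cases h2 : k = i
              · rw [h2, Function.update_self]
              · rw [Function.update_of_ne h2]
                exact hxn.le.trans (hS.mono i k hik hk)
            · rw [Function.update_of_ne h1]
              by_cases h2 : k = j
              · rw [h2, Function.update_self]
                exact hbefore i (by omega)
              · rw [Function.update_of_ne h2]
                exact hS.mono i k hik hk,
          fun i hi hil => by
            rw [Function.update_of_ne hi.ne, Function.update_of_ne hi.ne]
            exact hS.left i (by omega) hil,
          fun i hi hil => by
            rcases eq_or_lt_of_le hi with rfl | hi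
            · rw [Function.update_self]
              exact Or.inl had.le
            · rw [Function.update_of_ne hi.ne', Function.update_of_ne hi.ne']
              exact hS.right i hi hil,
          List.pairwise_cons.2 ⟨fun c hc => hxn.trans_le (hS.large c hc j (by omega)), hS.sorted⟩,
          fun c hc i hi => by
            rw [Function.update_of_ne hi.ne]
            rcases List.mem_cons.1 hc with rfl | hc
            · exact hbefore i hi
            · exact hS.large c hc i (by omega),
          Or.inr ⟨by omega, fun i hi => by
            rw [Function.update_of_ne hi.ne]
            have := hgrow (j - i) i (by omega)
            omega⟩⟩
      refine ⟨𝒯, h𝒯, ?_⟩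
      rw [hsum]
      refine Finset.sum_congr rfl fun T _ => ?_
      beta_reduce
      rw [diagList_setCell_self T (by omega) ha had hright,
        diagWord_setCell v T ha had (Nat.lt_succ_self d)]
      simp only [List.map_append, List.map_cons, List.map_nil, List.prod_append, List.prod_cons,
        List.prod_nil, mul_one, mul_assoc]

/-- Removing the diagonals one after the other. -/
theorem isTabSum_of_diagonals (hv : SatisfiesB v) {l R f d : ℕ} (hf : d + f = R + l + 1)
    (α n : ℕ → ℕ) (hS : IsState l R d l α n []) :
    IsTabSum l α n (ndet l (flagCol v α n)) fun T => diagWord v l R α T d f := by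
  induction f generalizing d α n with
  | zero =>
    have h0 : ∀ i < l, α i = 0 ∧ n i = 0 := by
      intro i hi
      have := hS.left i hi hi
      omega
    refine ⟨{fun _ _ => 0}, fun T => ?_, ?_⟩
    · rw [Finset.mem_singleton]
      constructor
      · rintro rfl
        refine ⟨fun _ _ _ => rfl, fun _ _ _ _ _ _ _ => le_rfl, fun j i i' hj _ hi' => ?_,
          fun j i hj hi => ?_, fun j hj hlt => ?_⟩
        · rw [(h0 j hj).1] at hi'; omega
        · rw [(h0 j hj).1] at hi; omega
        · rw [(h0 (j + 1) hj).1] at hlt; omega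
      · intro hT
        funext j i
        refine hT.outside j i fun h => ?_
        rw [(h0 j h.1).1] at h
        omega
    · rw [Finset.sum_singleton, ndet_one]
      · simp [diagWord]
      · intro j hj p _
        rw [flagCol, (h0 j hj).1, (h0 j hj).2, elem]
        congr 1
        rw [eq_iff_iff]
        omega
  | succ f ih =>
    have := isTabSum_of_isState hv (fun α n h => ih (d := d + 1) (by omega) α n h) l le_rfl α n [] hS
    rw [List.map_nil, List.prod_nil, insertAt_one] at this
    simpa only [mul_one, ← diagWord_succ] using this

/-- The column-flagged Schur function is the sum of the diagonal reading words of the flagged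
tableaux. -/
theorem isTabSum_diagWord (hv : SatisfiesB v) {l R : ℕ} (α n : ℕ → ℕ)
    (hα : ∀ i, i + 1 < l → α (i + 1) ≤ α i + 1) (hn : ∀ i k, i ≤ k → k < l → n i ≤ n k)
    (hR : ∀ i < l, α i ≤ R) :
    IsTabSum l α n (ndet l (flagCol v α n)) fun T => diagWord v l R α T 0 (R + l) := by
  obtain ⟨𝒯, h𝒯, hsum⟩ := isTabSum_of_diagonals hv (R := R) (f := R + l + 1) (d := 0) (by omega) α n
    ⟨hα, hn, fun i hi _ => by have := hR i hi; omega, fun i hi hil => by omega, List.Pairwise.nil,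
      by simp, Or.inl rfl⟩
  refine ⟨𝒯, h𝒯, hsum.trans (Finset.sum_congr rfl fun T _ => ?_)⟩
  beta_reduce
  unfold diagWord
  have hnil : diagList l R α T (0 + 1 * (R + l)) = [] := by
    unfold diagList
    rw [List.filterMap_eq_nil_iff]
    intro i hi
    have := List.mem_range.1 hi
    rw [if_neg (by omega)]
  rw [List.range'_concat, List.flatMap_append, List.flatMap_singleton, hnil, List.append_nil]

end Expansion

/-! ### The quotient by the ideal -/

/-- The quotient map `U → U / I_B`. -/
noncomputable def toQuot (N : ℕ) : U N →+* (idealB N).ringCon.Quotient := (idealB N).ringCon.mk'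

theorem toQuot_eq_iff {N : ℕ} (f g : U N) : toQuot N f = toQuot N g ↔ f - g ∈ idealB N := by
  rw [← TwoSidedIdeal.rel_iff]
  exact RingCon.eq _

/-- The images of the letters in `U / I_B`, extended by `0`. -/
noncomputable def letter (N : ℕ) (a : ℕ) : (idealB N).ringCon.Quotient :=
  if ha : a < N then toQuot N (u ⟨a, ha⟩) else 0

theorem satisfiesB_letter (N : ℕ) : SatisfiesB (letter N) := by
  constructor
  · intro a b hab
    by_cases hb : b < N
    · have hz : toQuot N _ = toQuot N 0 := (toQuot_eq_iff _ _).2 (by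
        rw [sub_zero]
        exact TwoSidedIdeal.subset_span
          (IsGenB.twoVar (⟨a, hab.trans hb⟩ : Fin N) ⟨b, hb⟩ hab))
      simp only [map_add, map_sub, map_mul, map_pow, map_zero] at hz
      rw [sub_sub, sub_eq_zero] at hz
      rwa [letter, letter, dif_pos hb, dif_pos (hab.trans hb)]
    · have : letter N b = 0 := dif_neg hb
      simp [this]
  · intro a b c hab hbc
    by_cases hc : c < N
    · rw [letter, letter, letter, dif_pos hc, dif_pos (hbc.trans hc), dif_pos (hab.trans (hbc.trans hc))]
      simp only [← map_mul]
      rw [toQuot_eq_iff]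
      exact TwoSidedIdeal.subset_span (IsGenB.knuth₁ _ _ _ hab hbc)
    · have : letter N c = 0 := dif_neg hc
      simp [this]
  · intro a b c hab hbc
    by_cases hc : c < N
    · rw [letter, letter, letter, dif_pos hc, dif_pos (hbc.trans hc), dif_pos (hab.trans (hbc.trans hc))]
      simp only [← map_mul]
      rw [toQuot_eq_iff]
      exact TwoSidedIdeal.subset_span (IsGenB.knuth₂ _ _ _ hab hbc)
    · have : letter N c = 0 := dif_neg hc
      simp [this]

theorem toQuot_mon {N : ℕ} (w : List (Fin N)) :
    toQuot N (mon w) = ((w.map Fin.val).map (letter N)).prod := by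
  rw [mon, map_list_prod, List.map_map, List.map_map]
  congr 1
  refine List.map_congr_left fun a _ => ?_
  rw [Function.comp_apply, Function.comp_apply, letter, dif_pos a.2]

theorem e_zero {N : ℕ} (S : Finset (Fin N)) : e S 0 = 1 := by
  simp [e, mon]

theorem e_of_neg {N : ℕ} (S : Finset (Fin N)) (k : ℤ) (hk : k < 0) : e S k = 0 := by
  rw [e, if_neg (by omega)]

theorem e_insert {N : ℕ} (S : Finset (Fin N)) (a : Fin N) (ha : ∀ b ∈ S, b < a) (k : ℤ) :
    e (insert a S) k = e S k + u a * e S (k - 1) := by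
  have haS : a ∉ S := fun h => lt_irrefl _ (ha a h)
  rcases lt_trichotomy k 0 with hk | rfl | hk
  · rw [e_of_neg _ _ hk, e_of_neg _ _ hk, e_of_neg _ _ (by omega)]
    simp
  · rw [e_zero, e_zero, e_of_neg _ _ (by omega)]
    simp
  · obtain ⟨k, rfl⟩ : ∃ m : ℕ, k = (m : ℤ) + 1 := ⟨(k - 1).toNat, by omega⟩
    rw [add_sub_cancel_right, e, e, e, if_pos (by omega), if_pos (by omega), if_pos (by omega),
      show ((k : ℤ) + 1).toNat = k + 1 by omega, Int.toNat_natCast,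
      Finset.powersetCard_succ_insert haS, Finset.sum_union, Finset.sum_image, Finset.mul_sum]
    · congr 1
      refine Finset.sum_congr rfl fun B hB => ?_
      have hBS := (Finset.mem_powersetCard.1 hB).1
      rw [Finset.sort_insert _ (fun b hb => (ha b (hBS hb)).le) (fun h => haS (hBS h))]
      simp [mon]
    · intro B hB C hC hBC
      have hB' := (Finset.mem_powersetCard.1 hB).1
      have hC' := (Finset.mem_powersetCard.1 hC).1
      rw [← Finset.erase_insert (fun h => haS (hB' h)), hBC,
        Finset.erase_insert (fun h => haS (hC' h))]
    · rw [Finset.disjoint_left]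
      intro B hB hB'
      obtain ⟨C, _, rfl⟩ := Finset.mem_image.1 hB'
      exact haS ((Finset.mem_powersetCard.1 hB).1 (Finset.mem_insert_self _ _))

theorem letters_self (N : ℕ) : letters N N = Finset.univ := by
  simp [letters]

theorem toQuot_e (N m : ℕ) (hm : m ≤ N) (k : ℤ) :
    toQuot N (e (letters N m) k) = elem (letter N) m k := by
  induction m generalizing k with
  | zero =>
    have h0 : letters N 0 = ∅ := by simp [letters]
    rw [h0, elem]
    rcases lt_trichotomy k 0 with hk | rfl | hk
    · rw [e_of_neg _ _ hk, if_neg hk.ne, map_zero]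
    · rw [e_zero, if_pos rfl, map_one]
    · rw [e, if_pos hk.le, if_neg hk.ne', Finset.powersetCard_eq_empty.2, Finset.sum_empty, map_zero]
      rw [Finset.card_empty]
      omega
  | succ m ih =>
    have hins : letters N (m + 1) = insert ⟨m, hm⟩ (letters N m) := by
      ext a
      simp only [letters, Finset.mem_filter, Finset.mem_univ, true_and, Finset.mem_insert, Fin.ext_iff]
      omega
    rw [hins, e_insert _ _ (by simp [letters, Fin.lt_def]), map_add, map_mul, ih (by omega),
      ih (by omega), elem, letter,
      dif_pos (Nat.lt_of_succ_le hm)]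

/-- A function on `{0, …, l - 1}` extended by `0`. -/
def extendZero {l : ℕ} (α : Fin l → ℕ) (j : ℕ) : ℕ := if hj : j < l then α ⟨j, hj⟩ else 0

theorem extendZero_apply {l : ℕ} (α : Fin l → ℕ) (j : Fin l) : extendZero α j = α j := by
  rw [extendZero, dif_pos j.2]

theorem extendZero_of_lt {l : ℕ} (α : Fin l → ℕ) {j : ℕ} (hj : j < l) :
    extendZero α j = α ⟨j, hj⟩ := dif_pos hj

theorem toQuot_flaggedSchur (N : ℕ) {l : ℕ} (α n : Fin l → ℕ) (hn : ∀ j, n j ≤ N) :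
    toQuot N (flaggedSchur N α n) =
      ndet l (flagCol (letter N) (extendZero α) (extendZero n)) := by
  rw [flaggedSchur, ndet, map_sum]
  refine Finset.sum_congr rfl fun π _ => ?_
  rw [map_zsmul, map_list_prod, List.map_ofFn]
  congr 3
  funext j
  rw [Function.comp_apply, toQuot_e N _ (hn j), flagCol, extendZero_apply, extendZero_apply]

/-- A filling extended by `0`. -/
def extendFilling {N l : ℕ} {α : Fin l → ℕ} (T : Filling N α) (j i : ℕ) : ℕ :=
  if hc : ∃ hj : j < l, i < α ⟨j, hj⟩ then (T ⟨j, hc.1⟩ ⟨i, hc.2⟩ : ℕ) else 0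

theorem extendFilling_of_lt {N l : ℕ} {α : Fin l → ℕ} (T : Filling N α) (j : Fin l) {i : ℕ}
    (hi : i < α j) : extendFilling T j i = T j ⟨i, hi⟩ :=
  dif_pos ⟨j.2, hi⟩

theorem isTab_extendFilling_iff {N l : ℕ} {α n : Fin l → ℕ} (T : Filling N α) :
    IsTab l (extendZero α) (extendZero n) (extendFilling T) ↔ IsFlaggedSSYT α n T := by
  constructor
  · intro h
    constructor
    · intro j k hjk i hj hk
      have := h.row_weak j k i hjk k.2 (by rwa [extendZero_apply]) (by rwa [extendZero_apply])
      rw [extendFilling_of_lt T j hj, extendFilling_of_lt T k hk] at this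
      exact this
    · intro j i i' hii'
      have := h.col_strict j i i' j.2 hii' (by rw [extendZero_apply]; exact i'.2)
      rw [extendFilling_of_lt T j i.2, extendFilling_of_lt T j i'.2] at this
      exact this
    · intro j i
      have := h.flag j i j.2 (by rw [extendZero_apply]; exact i.2)
      rwa [extendFilling_of_lt T j i.2, extendZero_apply] at this
    · intro j k hk hlt i hi
      have := h.bottom j (by omega)
      rw [← hk, extendZero_apply, extendZero_apply, extendZero_apply] at this
      have h1 : α k - 1 = (i : ℕ) := by omega
      rw [h1, extendFilling_of_lt T k i.2] at this
      exact this hlt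
  · intro h
    constructor
    · intro j i hji
      rw [extendFilling, dif_neg]
      rintro ⟨hj, hi⟩
      exact hji ⟨hj, by rwa [extendZero_of_lt α hj]⟩
    · intro j k i hjk hk hi hi'
      have hj : j < l := hjk.trans hk
      rw [extendZero_of_lt α hj] at hi
      rw [extendZero_of_lt α hk] at hi'
      have := h.row_weak ⟨j, hj⟩ ⟨k, hk⟩ hjk i hi hi'
      rw [Fin.le_def, ← extendFilling_of_lt T _ hi, ← extendFilling_of_lt T _ hi'] at this
      exact this
    · intro j i i' hj hii' hi'
      rw [extendZero_of_lt α hj] at hi'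
      have hi : i < α ⟨j, hj⟩ := hii'.trans hi'
      have := h.col_strict ⟨j, hj⟩ (show (⟨i, hi⟩ : Fin _) < ⟨i', hi'⟩ from hii')
      rw [Fin.lt_def, ← extendFilling_of_lt T _ hi, ← extendFilling_of_lt T _ hi'] at this
      exact this
    · intro j i hj hi
      rw [extendZero_of_lt α hj] at hi
      have := h.flag ⟨j, hj⟩ ⟨i, hi⟩
      rw [← extendFilling_of_lt T _ hi] at this
      rwa [extendZero_of_lt n hj]
    · intro j hj hlt
      rw [extendZero_of_lt α hj, extendZero_of_lt α (Nat.lt_of_succ_lt hj)] at hlt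
      rw [extendZero_of_lt α hj, extendZero_of_lt n (Nat.lt_of_succ_lt hj)]
      have hi : α ⟨j + 1, hj⟩ - 1 < α ⟨j + 1, hj⟩ := by omega
      have := h.bottom ⟨j, Nat.lt_of_succ_lt hj⟩ ⟨j + 1, hj⟩ rfl hlt ⟨_, hi⟩ (by dsimp only; omega)
      rw [← extendFilling_of_lt T _ hi] at this
      exact this

theorem map_val_diagread {N l : ℕ} {α : Fin l → ℕ} (T : Filling N α) :
    (diagread T).map Fin.val = (List.range' 0 (Finset.univ.sup α + l)).flatMap
      (diagList l (Finset.univ.sup α) (extendZero α) (extendFilling T)) := by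
  rw [diagread, List.map_flatMap, List.range_eq_range']
  congr 1
  funext d
  rw [diagList, List.map_filterMap, ← List.map_coe_finRange_eq_range, List.filterMap_map]
  congr 1
  funext j
  rw [Function.comp_apply, extendZero_apply]
  split_ifs with hc
  · rw [extendFilling_of_lt T j hc.2]
    rfl
  · rfl

/-- The expansion of the column-flagged Schur functions, modulo the ideal. -/
theorem toQuot_flaggedSchur_eq_sum (N : ℕ) {l : ℕ} (α n : Fin l → ℕ)
    (hα : ∀ j k : Fin l, (k : ℕ) = j + 1 → α k ≤ α j + 1) (hn : Monotone n) (hN : ∀ j, n j ≤ N) :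
    toQuot N (flaggedSchur N α n) =
      toQuot N (∑ T ∈ flaggedSSYT N α n, mon (diagread T)) := by
  obtain ⟨𝒯, h𝒯, hsum⟩ := isTabSum_diagWord (satisfiesB_letter N) (l := l)
    (R := Finset.univ.sup α) (extendZero α) (extendZero n)
    (fun i hi => by
      rw [extendZero_of_lt α hi, extendZero_of_lt α (Nat.lt_of_succ_lt hi)]
      exact hα ⟨i, Nat.lt_of_succ_lt hi⟩ ⟨i + 1, hi⟩ rfl)
    (fun i k hik hk => by
      rw [extendZero_of_lt n hk, extendZero_of_lt n (hik.trans_lt hk)]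
      exact hn hik)
    (fun i hi => by
      rw [extendZero_of_lt α hi]
      exact Finset.le_sup (Finset.mem_univ _))
  classical
  rw [toQuot_flaggedSchur N α n hN, hsum, map_sum]
  symm
  refine Finset.sum_bij (fun T _ => extendFilling T) ?_ ?_ ?_ ?_
  · intro T hT
    rw [flaggedSSYT, Finset.mem_filter] at hT
    rw [h𝒯, isTab_extendFilling_iff]
    exact hT.2
  · intro T _ S _ hTS
    funext j i
    have := congrFun (congrFun hTS j) i
    rw [extendFilling_of_lt T j i.2, extendFilling_of_lt S j i.2] at this
    exact Fin.ext this
  · intro S hS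
    rw [h𝒯] at hS
    have hlt : ∀ (j : Fin l) (i : Fin (α j)), S j i < N := by
      intro j i
      have := hS.flag j i j.2 (by rw [extendZero_apply]; exact i.2)
      rw [extendZero_apply] at this
      exact this.trans_le (hN j)
    let T : Filling N α := fun j i => ⟨S j i, hlt j i⟩
    have hT : extendFilling T = S := by
      funext j i
      rw [extendFilling]
      split_ifs with hc
      · rfl
      · refine (hS.outside j i fun h => hc ⟨h.1, ?_⟩).symm
        have := h.2
        rwa [extendZero_of_lt α h.1] at this
    refine ⟨T, ?_, hT⟩
    rw [flaggedSSYT, Finset.mem_filter]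
    refine ⟨Finset.mem_univ _, ?_⟩
    rwa [← isTab_extendFilling_iff, hT]
  · intro T _
    rw [toQuot_mon, map_val_diagread]
    rfl

theorem isMonomialPositive_flaggedSchur (N : ℕ) {l : ℕ} (α n : Fin l → ℕ)
    (hα : ∀ j k : Fin l, (k : ℕ) = j + 1 → α k ≤ α j + 1) (hn : Monotone n) (hN : ∀ j, n j ≤ N) :
    IsMonomialPositive (idealB N) (flaggedSchur N α n) :=
  ⟨_, AddSubmonoid.sum_mem _ fun _ _ => AddSubmonoid.subset_closure ⟨_, rfl⟩,
    (toQuot_eq_iff _ _).1 (toQuot_flaggedSchur_eq_sum N α n hα hn hN)⟩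

theorem ncSchur_eq_flaggedSchur (N : ℕ) (μ : YoungDiagram) :
    ncSchur N μ = flaggedSchur N (fun j : Fin (μ.rowLen 0) => μ.colLen j) fun _ => N := by
  rw [ncSchur, flaggedSchur, letters_self]

/-! ### The Pieri rule for Jacobi–Trudi determinants -/

section Pieri

variable {R : Type*} [CommRing R]

/-- The Jacobi–Trudi determinant `det (e_{α_i - i + j})` of size `t` in a commutative ring, `α` being
the sequence of column lengths. -/
def jacobiTrudi (e : ℤ → R) (t : ℕ) (α : ℕ → ℕ) : R :=
  (Matrix.of fun i j : Fin t => e ((α i : ℤ) - (i : ℕ) + (j : ℕ))).det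

/-- Lengthening by one the columns in `S`. -/
def bump (α : ℕ → ℕ) (S : Finset ℕ) (j : ℕ) : ℕ := α j + if j ∈ S then 1 else 0

/-- Summing over all ways to shift the index in `k` of the rows is the same as summing over all ways
to shift the index in `k` of the columns. -/
theorem sum_det_shift_rows {t : ℕ} (e : ℤ → R) (β : Fin t → ℤ) (k : ℕ) :
    ∑ S ∈ (Finset.univ : Finset (Fin t)).powersetCard k,
        (Matrix.of fun i j : Fin t => e (β i + (j : ℕ) + if i ∈ S then 1 else 0)).det =
      ∑ S ∈ (Finset.univ : Finset (Fin t)).powersetCard k,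
        (Matrix.of fun i j : Fin t => e (β i + (j : ℕ) + if j ∈ S then 1 else 0)).det := by
  simp only [Matrix.det_apply]
  rw [Finset.sum_comm, Finset.sum_comm (s := Finset.powersetCard k Finset.univ)]
  refine Finset.sum_congr rfl fun σ _ => ?_
  refine Finset.sum_equiv (σ⁻¹ : Equiv.Perm (Fin t)).finsetCongr (fun S => ?_) fun S _ => ?_
  · simp [Finset.mem_powersetCard]
  · simp only [Matrix.of_apply, Equiv.finsetCongr_apply, Finset.mem_map_equiv]
    rfl

/-- Of the column shifts, only the shift of the last `k` columns has a nonzero determinant. -/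
theorem sum_det_shift_columns {t : ℕ} (e : ℤ → R) (β : Fin t → ℤ) (k : ℕ) (hk : k ≤ t) :
    ∑ S ∈ (Finset.univ : Finset (Fin t)).powersetCard k,
        (Matrix.of fun i j : Fin t => e (β i + (j : ℕ) + if j ∈ S then 1 else 0)).det =
      (Matrix.of fun i j : Fin t => e (β i + (j : ℕ) + if t - k ≤ (j : ℕ) then 1 else 0)).det := by
  set S₀ : Finset (Fin t) := Finset.univ.filter fun j => t - k ≤ (j : ℕ) with hS₀
  have hcard : S₀.card = k := by
    have h1 : S₀.map Fin.valEmbedding = Finset.Ico (t - k) t := by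
      ext x
      simp only [hS₀, Finset.mem_map, Finset.mem_filter, Finset.mem_univ, true_and,
        Fin.valEmbedding_apply, Finset.mem_Ico]
      constructor
      · rintro ⟨j, hj, rfl⟩
        exact ⟨hj, j.2⟩
      · rintro ⟨h1, h2⟩
        exact ⟨⟨x, h2⟩, h1, rfl⟩
    rw [← Finset.card_map Fin.valEmbedding, h1, Nat.card_Ico]
    omega
  rw [Finset.sum_eq_single S₀]
  · simp [hS₀]
  · intro S hS hne
    have hSc := (Finset.mem_powersetCard.1 hS).2
    -- Some column of `S` is followed by a column outside `S`: these two columns are equal.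
    obtain ⟨j, hj, hj1, hjS⟩ : ∃ j : Fin t, j ∈ S ∧ ∃ hj : (j : ℕ) + 1 < t,
        (⟨j + 1, hj⟩ : Fin t) ∉ S := by
      by_contra hc
      push Not at hc
      have hup : ∀ j ∈ S, ∀ d : ℕ, ∀ h : (j : ℕ) + d < t, (⟨j + d, h⟩ : Fin t) ∈ S := by
        intro j hj d
        induction d with
        | zero => exact fun _ => hj
        | succ d ih => exact fun h => hc _ (ih (by omega)) h
      obtain ⟨j, hj, hj'⟩ : ∃ j ∈ S, j ∉ S₀ := by
        by_contra hc'
        push Not at hc'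
        exact hne (Finset.eq_of_subset_of_card_le hc' (by rw [hcard, hSc]))
      have hlt : (j : ℕ) < t - k := by
        by_contra hc'
        exact hj' (Finset.mem_filter.2 ⟨Finset.mem_univ _, by omega⟩)
      have hsub : insert j S₀ ⊆ S := by
        intro i hi
        rcases Finset.mem_insert.1 hi with rfl | hi
        · exact hj
        · have : t - k ≤ (i : ℕ) := by simpa [hS₀] using hi
          have := hup j hj (i - j) (by omega)
          convert this using 1
          ext
          simp only
          omega
      have := Finset.card_le_card hsub
      rw [Finset.card_insert_of_notMem hj', hcard, hSc] at this
      omega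
    refine Matrix.det_zero_of_column_eq (i := j) (j := ⟨j + 1, hj1⟩) ?_ fun i => ?_
    · intro h
      have := congrArg Fin.val h
      simp at this
    · rw [Matrix.of_apply, Matrix.of_apply, if_pos hj, if_neg hjS]
      congr 1
      push_cast
      ring
  · intro h
    exact absurd (Finset.mem_powersetCard.2 ⟨Finset.subset_univ _, hcard⟩) h

/-- The minors obtained by shifting the last `k` columns satisfy the recursion that characterizes
the complete homogeneous symmetric functions: expand a determinant with a repeated row. -/
theorem det_shift_last_columns {t : ℕ} (e : ℤ → R) (he0 : e 0 = 1) (he : ∀ k < 0, e k = 0)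
    (h : ℕ → R) (h0 : h 0 = 1)
    (hrec : ∀ r, 0 < r → ∑ k ∈ Finset.range (r + 1), (-1) ^ k * e ((r : ℤ) - k) * h k = 0)
    (β : Fin t → ℤ) (K : ℕ) (hK : K ≤ t) (hβ : ∀ i : Fin t, t - K ≤ (i : ℕ) → β i = -(i : ℕ))
    (k : ℕ) (hk : k ≤ K) :
    (Matrix.of fun i j : Fin t => e (β i + (j : ℕ) + if t - k ≤ (j : ℕ) then 1 else 0)).det =
      h k * (Matrix.of fun i j : Fin t => e (β i + (j : ℕ))).det := by
  set m : ℕ → R := fun k =>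
    (Matrix.of fun i j : Fin t => e (β i + (j : ℕ) + if t - k ≤ (j : ℕ) then 1 else 0)).det with hm
  have hm0 : m 0 = (Matrix.of fun i j : Fin t => e (β i + (j : ℕ))).det := by
    refine congrArg Matrix.det (Matrix.ext fun i j => ?_)
    rw [Matrix.of_apply, Matrix.of_apply, if_neg (by omega), add_zero]
  have hmrec : ∀ r, 0 < r → r ≤ K →
      ∑ k ∈ Finset.range (r + 1), (-1) ^ k * e ((r : ℤ) - k) * m k = 0 := by
    intro r hr hrK
    let i₀ : Fin t := ⟨t - r, by omega⟩
    let W : Matrix (Fin (t + 1)) (Fin (t + 1)) R :=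
      Matrix.of fun i j => e ((Fin.cons (β i₀) β : Fin (t + 1) → ℤ) i + (j : ℕ))
    have hW : W.det = 0 := by
      refine Matrix.det_zero_of_row_eq (i := 0) (j := i₀.succ) (Fin.succ_ne_zero _).symm ?_
      funext j
      simp [W]
    rw [Matrix.det_succ_row_zero] at hW
    have hterm : ∀ j : Fin (t + 1),
        (-1) ^ (j : ℕ) * W 0 j * (W.submatrix Fin.succ j.succAbove).det =
          (-1) ^ (j : ℕ) * e ((j : ℤ) - (t - r : ℕ)) * m (t - j) := by
      intro j
      congr 1
      · congr 1
        simp only [W, Matrix.of_apply, Fin.cons_zero, i₀]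
        rw [hβ _ (by simp only; omega)]
        congr 1
        simp only
        ring
      · refine congrArg Matrix.det (Matrix.ext fun a b => ?_)
        simp only [W, Matrix.submatrix_apply, Matrix.of_apply, Fin.cons_succ]
        rw [add_assoc]
        congr 2
        have hj : t - (t - (j : ℕ)) = j := by omega
        rw [hj]
        by_cases hb : (j : ℕ) ≤ b
        · rw [Fin.succAbove_of_le_castSucc _ _ (by rwa [Fin.le_def]), if_pos hb]
          simp
        · rw [Fin.succAbove_of_castSucc_lt _ _ (by rw [Fin.lt_def, Fin.val_castSucc]; omega), if_neg hb]
          simp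
    rw [Finset.sum_congr rfl fun j _ => hterm j,
      Fin.sum_univ_eq_sum_range
        (fun j => (-1) ^ j * e ((j : ℤ) - (t - r : ℕ)) * m (t - j)) (t + 1),
      ← Finset.sum_range_reflect] at hW
    have hW' : ∑ k ∈ Finset.range (t + 1), (-1) ^ (t - k) * e ((r : ℤ) - k) * m k = 0 := by
      rw [← hW]
      refine Finset.sum_congr rfl fun k hk => ?_
      rw [Finset.mem_range] at hk
      have h1 : t + 1 - 1 - k = t - k := by omega
      have h2 : t - (t - k) = k := by omega
      rw [h1, h2]
      congr 3
      omega
    rw [← Finset.sum_subset (Finset.range_subset_range.2 (by omega : r + 1 ≤ t + 1))] at hW'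
    · have h3 := congrArg (fun x => (-1) ^ t * x) hW'
      simp only [mul_zero, Finset.mul_sum] at h3
      rw [← h3]
      refine Finset.sum_congr rfl fun k hk => ?_
      rw [Finset.mem_range] at hk
      have h4 : (-1 : R) ^ t = (-1) ^ k * (-1) ^ (t - k) := by
        rw [← pow_add]; congr 1; omega
      have h5 : (-1 : R) ^ (t - k) * (-1) ^ (t - k) = 1 := by
        rw [← mul_pow]; simp
      rw [h4]
      linear_combination (-(-1) ^ k * e ((r : ℤ) - k) * m k) * h5
    · intro k _ hk
      rw [Finset.mem_range] at hk
      rw [he _ (by omega), mul_zero, zero_mul]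
  rw [← hm0]
  change m k = h k * m 0
  induction k using Nat.strong_induction_on with
  | _ k ih =>
    rcases Nat.eq_zero_or_pos k with rfl | hk0
    · rw [h0, one_mul]
    · have h1 := hmrec k hk0 hk
      have h2 := hrec k hk0
      rw [Finset.sum_range_succ] at h1 h2
      rw [sub_self, he0, mul_one] at h1 h2
      have h3 : ∑ i ∈ Finset.range k, (-1) ^ i * e ((k : ℤ) - i) * m i =
          (∑ i ∈ Finset.range k, (-1) ^ i * e ((k : ℤ) - i) * h i) * m 0 := by
        rw [Finset.sum_mul]
        refine Finset.sum_congr rfl fun i hi => ?_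
        rw [Finset.mem_range] at hi
        rw [ih i hi (by omega), ← mul_assoc]
      have h5 : (-1 : R) ^ k * (-1) ^ k = 1 := by
        rw [← mul_pow]; simp
      rw [h3] at h1
      linear_combination (-1) ^ k * h1 - (-1) ^ k * m 0 * h2 - (m k - h k * m 0) * h5

/-- The Pieri rule: multiplication by `h_k` adds horizontal strips of size `k`.  The condition `hα0`
says that there is room for `k` new columns, so that no strip is cut off. -/
theorem jacobiTrudi_pieri (e : ℤ → R) (he0 : e 0 = 1) (he : ∀ k < 0, e k = 0)
    (h : ℕ → R) (h0 : h 0 = 1)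
    (hrec : ∀ r, 0 < r → ∑ k ∈ Finset.range (r + 1), (-1) ^ k * e ((r : ℤ) - k) * h k = 0)
    {t k : ℕ} {α : ℕ → ℕ} (hk : k ≤ t) (hα : Antitone α) (hα0 : ∀ i, t - k ≤ i → α i = 0)
    [DecidablePred fun S : Finset ℕ => Antitone (bump α S)] :
    ∑ S ∈ ((Finset.range t).powersetCard k).filter (fun S => Antitone (bump α S)),
      jacobiTrudi e t (bump α S) = h k * jacobiTrudi e t α := by
  rw [Finset.sum_filter_of_ne]
  · have hr : Finset.range t = (Finset.univ : Finset (Fin t)).map Fin.valEmbedding := by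
      rw [Fin.map_valEmbedding_univ]
      ext; simp
    rw [hr, Finset.powersetCard_map, Finset.sum_map]
    have h1 := sum_det_shift_rows e (fun i : Fin t => (α i : ℤ) - (i : ℕ)) k
    rw [sum_det_shift_columns e _ k hk, det_shift_last_columns e he0 he h h0 hrec _ k hk
      (fun i hi => by rw [hα0 _ hi]; simp) k le_rfl] at h1
    rw [jacobiTrudi, ← h1]
    refine Finset.sum_congr rfl fun S _ => ?_
    rw [jacobiTrudi]
    congr 1
    ext i j
    rw [Matrix.of_apply, Matrix.of_apply, bump]
    congr 1
    have : ((i : ℕ) ∈ S.map Fin.valEmbedding) ↔ i ∈ S := by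
      simp [Fin.exists_iff]
    simp only [RelEmbedding.coe_toEmbedding, Finset.mapEmbedding_apply, this]
    split_ifs <;> push_cast <;> ring
  · intro S hS hne
    by_contra hanti
    apply hne
    obtain ⟨i, hi⟩ : ∃ i, bump α S i < bump α S (i + 1) := by
      by_contra hc
      push Not at hc
      exact hanti (antitone_nat_of_succ_le hc)
    have hSr := (Finset.mem_powersetCard.1 hS).1
    have h1 : α (i + 1) ≤ α i := hα (Nat.le_succ i)
    have h2 : i + 1 ∈ S ∧ i ∉ S ∧ α i = α (i + 1) := by
      unfold bump at hi
      by_cases h3 : i ∈ S <;> by_cases h4 : i + 1 ∈ S <;>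
        simp only [h3, h4, if_true, if_false] at hi ⊢ <;> first | omega | simp; omega
    have hit : i + 1 < t := Finset.mem_range.1 (hSr h2.1)
    refine Matrix.det_zero_of_row_eq (i := ⟨i, by omega⟩) (j := ⟨i + 1, hit⟩) (by simp) ?_
    funext j
    simp only [Matrix.of_apply, bump, if_pos h2.1, if_neg h2.2.1, h2.2.2]
    congr 1
    push_cast
    ring

end Pieri

/-! ### Iterating the Pieri rule -/

/-- `(α, T)` is a semistandard tableau with column lengths `α`, at most `t` columns and entries
less than `b`, in which every `x < b` occurs `m x` times; `T i j` is the entry in row `i` and column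
`j`.  Since a column contains `x` at most once, occurrences of `x` are counted by columns. -/
structure IsContentTab (t b : ℕ) (m : ℕ → ℕ) (p : (ℕ → ℕ) × (ℕ → ℕ → ℕ)) : Prop where
  anti : Antitone p.1
  zero : ∀ j, t ≤ j → p.1 j = 0
  outside : ∀ i j, p.1 j ≤ i → p.2 i j = 0
  row : ∀ i j j', j < j' → i < p.1 j' → p.2 i j ≤ p.2 i j'
  col : ∀ i i' j, i < i' → i' < p.1 j → p.2 i j < p.2 i' j
  lt : ∀ i j, i < p.1 j → p.2 i j < b
  content : ∀ x < b, ((Finset.range t).filter fun j => ∃ i < p.1 j, p.2 i j = x).card = m x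
  size : ∑ j ∈ Finset.range t, p.1 j = ∑ x ∈ Finset.range b, m x

/-- Adding a cell with entry `b` at the bottom of each column in `S`. -/
def grow (b : ℕ) (p : (ℕ → ℕ) × (ℕ → ℕ → ℕ)) (S : Finset ℕ) : (ℕ → ℕ) × (ℕ → ℕ → ℕ) :=
  (bump p.1 S, fun i j => if j ∈ S ∧ i = p.1 j then b else p.2 i j)

/-- The columns containing the entry `b`. -/
def columnsWith (t b : ℕ) (p : (ℕ → ℕ) × (ℕ → ℕ → ℕ)) : Finset ℕ :=
  (Finset.range t).filter fun j => ∃ i < p.1 j, p.2 i j = b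

/-- Removing the entries `b` from a tableau with entries at most `b`. -/
def shrink (t b : ℕ) (p : (ℕ → ℕ) × (ℕ → ℕ → ℕ)) : (ℕ → ℕ) × (ℕ → ℕ → ℕ) :=
  (fun j => p.1 j - if j ∈ columnsWith t b p then 1 else 0,
    fun i j => if j ∈ columnsWith t b p ∧ i + 1 = p.1 j then 0 else p.2 i j)

section Grow

variable {t b : ℕ} {m : ℕ → ℕ} {p : (ℕ → ℕ) × (ℕ → ℕ → ℕ)}

theorem IsContentTab.columnsWith_grow (hp : IsContentTab t b m p) {S : Finset ℕ}
    (hS : S ⊆ Finset.range t) : columnsWith t b (grow b p S) = S := by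
  ext j
  rw [columnsWith, Finset.mem_filter]
  simp only [grow, bump]
  constructor
  · rintro ⟨_, i, hi, hij⟩
    by_contra hj
    simp only [hj, false_and, if_false, add_zero] at hi hij
    exact (hp.lt i j hi).ne hij
  · intro hj
    exact ⟨hS hj, p.1 j, by simp [hj], by simp [hj]⟩

theorem IsContentTab.shrink_grow (hp : IsContentTab t b m p) {S : Finset ℕ}
    (hS : S ⊆ Finset.range t) : shrink t b (grow b p S) = p := by
  rw [shrink, hp.columnsWith_grow hS]
  refine Prod.ext (funext fun j => ?_) (funext fun i => funext fun j => ?_)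
  · simp [grow, bump]
  · by_cases hj : j ∈ S
    · simp only [hj, grow, bump, true_and, if_true, Nat.add_right_cancel_iff]
      split_ifs with h
      · rw [h, hp.outside _ _ le_rfl]
      · rfl
    · simp [hj, grow]

theorem IsContentTab.grow (hp : IsContentTab t b m p) {S : Finset ℕ} (hS : S ⊆ Finset.range t)
    (hcard : S.card = m b) (hanti : Antitone (bump p.1 S)) :
    IsContentTab t (b + 1) m (NCSchur.grow b p S) := by
  have hcell : ∀ i j, i < bump p.1 S j → (i < p.1 j ∧ (NCSchur.grow b p S).2 i j = p.2 i j) ∨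
      (i = p.1 j ∧ j ∈ S ∧ (NCSchur.grow b p S).2 i j = b) := by
    intro i j hi
    unfold bump at hi
    by_cases hj : j ∈ S
    · rw [if_pos hj] at hi
      rcases lt_or_ge i (p.1 j) with h | h
      · exact Or.inl ⟨h, if_neg fun h' => h.ne h'.2⟩
      · have : i = p.1 j := by omega
        exact Or.inr ⟨this, hj, if_pos ⟨hj, this⟩⟩
    · rw [if_neg hj] at hi
      exact Or.inl ⟨hi, if_neg fun h' => hj h'.1⟩
  have hle : ∀ j, p.1 j ≤ bump p.1 S j := fun j => Nat.le_add_right _ _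
  constructor
  · exact hanti
  · intro j hj
    have : j ∉ S := fun h => by have := Finset.mem_range.1 (hS h); omega
    simp [NCSchur.grow, bump, this, hp.zero j hj]
  · intro i j hij
    have h1 : ¬(j ∈ S ∧ i = p.1 j) := by
      rintro ⟨h1, h2⟩
      simp only [NCSchur.grow, bump, if_pos h1] at hij
      omega
    simp only [NCSchur.grow, if_neg h1]
    exact hp.outside i j ((hle j).trans hij)
  · intro i j j' hjj' hi
    rcases hcell i j' hi with ⟨h1, h2⟩ | ⟨h1, h2, h3⟩ <;>
      rcases hcell i j (hi.trans_le (hanti hjj'.le)) with ⟨h4, h5⟩ | ⟨h4, h5, h6⟩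
    · rw [h2, h5]; exact hp.row i j j' hjj' h1
    · have := hp.anti hjj'.le
      omega
    · rw [h3, h5]; exact (hp.lt i j h4).le
    · rw [h3, h6]
  · intro i i' j hii' hi'
    rcases hcell i' j hi' with ⟨h1, h2⟩ | ⟨h1, h2, h3⟩ <;>
      rcases hcell i j (hii'.trans hi') with ⟨h4, h5⟩ | ⟨h4, h5, h6⟩
    · rw [h2, h5]; exact hp.col i i' j hii' h1
    · omega
    · rw [h3, h5]; exact hp.lt i j h4
    · omega
  · intro i j hi
    rcases hcell i j hi with ⟨h1, h2⟩ | ⟨h1, h2, h3⟩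
    · rw [h2]; exact (hp.lt i j h1).trans (Nat.lt_succ_self b)
    · rw [h3]; exact Nat.lt_succ_self b
  · intro x hx
    rcases eq_or_lt_of_le (Nat.le_of_lt_succ hx) with rfl | hx
    · rw [← hcard]
      congr 1
      exact hp.columnsWith_grow hS
    · rw [← hp.content x hx]
      congr 1
      refine Finset.filter_congr fun j _ => ?_
      constructor
      · rintro ⟨i, hi, hij⟩
        rcases hcell i j hi with ⟨h1, h2⟩ | ⟨h1, h2, h3⟩
        · exact ⟨i, h1, by rw [← h2, hij]⟩
        · omega
      · rintro ⟨i, hi, hij⟩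
        have hi' : i < bump p.1 S j := hi.trans_le (hle j)
        rcases hcell i j hi' with ⟨h1, h2⟩ | ⟨h1, h2, h3⟩
        · exact ⟨i, hi', by rw [h2, hij]⟩
        · omega
  · rw [Finset.sum_range_succ, ← hp.size, ← hcard]
    simp only [NCSchur.grow, bump, Finset.sum_add_distrib]
    congr 1
    rw [Finset.sum_ite_mem, Finset.sum_const, smul_eq_mul, mul_one, Finset.inter_eq_right.2 hS]

theorem IsContentTab.eq_bottom (hp : IsContentTab t (b + 1) m p) {i j : ℕ} (hi : i < p.1 j)
    (hb : p.2 i j = b) : i + 1 = p.1 j := by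
  by_contra hne
  have h1 := hp.col i (i + 1) j (Nat.lt_succ_self i) (by omega)
  have h2 := hp.lt (i + 1) j (by omega)
  omega

theorem IsContentTab.mem_columnsWith_iff (hp : IsContentTab t (b + 1) m p) {j : ℕ} :
    j ∈ columnsWith t b p ↔ 0 < p.1 j ∧ p.2 (p.1 j - 1) j = b := by
  simp only [columnsWith, Finset.mem_filter, Finset.mem_range]
  constructor
  · rintro ⟨_, i, hi, hij⟩
    have := hp.eq_bottom hi hij
    exact ⟨by omega, by rw [← this, Nat.add_sub_cancel, hij]⟩
  · rintro ⟨h1, h2⟩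
    refine ⟨?_, p.1 j - 1, by omega, h2⟩
    by_contra hj
    have := hp.zero j (by omega)
    omega

theorem IsContentTab.shrink (hp : IsContentTab t (b + 1) m p) :
    IsContentTab t b m (NCSchur.shrink t b p) ∧ bump (NCSchur.shrink t b p).1 (columnsWith t b p) = p.1 ∧
      NCSchur.grow b (NCSchur.shrink t b p) (columnsWith t b p) = p := by
  have hbump : bump (NCSchur.shrink t b p).1 (columnsWith t b p) = p.1 := by
    funext j
    simp only [bump, NCSchur.shrink]
    by_cases hj : j ∈ columnsWith t b p
    · have := (hp.mem_columnsWith_iff.1 hj).1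
      simp only [hj, if_true]
      omega
    · simp [hj]
  have hcell : ∀ i j, i < (NCSchur.shrink t b p).1 j →
      i < p.1 j ∧ (NCSchur.shrink t b p).2 i j = p.2 i j ∧ p.2 i j < b := by
    intro i j hi
    simp only [NCSchur.shrink] at hi ⊢
    have h1 : ¬(j ∈ columnsWith t b p ∧ i + 1 = p.1 j) := by
      rintro ⟨h1, h2⟩
      rw [if_pos h1] at hi
      omega
    have h2 : i < p.1 j := by omega
    refine ⟨h2, if_neg h1, lt_of_le_of_ne (Nat.le_of_lt_succ (hp.lt i j h2)) fun h3 => h1 ⟨?_, ?_⟩⟩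
    · have h4 := hp.eq_bottom h2 h3
      rw [hp.mem_columnsWith_iff]
      exact ⟨by omega, by rw [← h4, Nat.add_sub_cancel, h3]⟩
    · exact hp.eq_bottom h2 h3
  have hcell' : ∀ i j, i < p.1 j → p.2 i j < b → i < (NCSchur.shrink t b p).1 j := by
    intro i j hi hij
    simp only [NCSchur.shrink]
    split_ifs with hj
    · have h1 := (hp.mem_columnsWith_iff.1 hj)
      have : i ≠ p.1 j - 1 := by
        rintro rfl
        omega
      omega
    · simpa using hi
  have hanti : Antitone (NCSchur.shrink t b p).1 := by
    intro j j' hjj'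
    have h1 := hp.anti hjj'
    simp only [NCSchur.shrink]
    by_cases hj : j ∈ columnsWith t b p
    · by_cases hj' : j' ∈ columnsWith t b p
      · simp only [hj, hj', if_true]; omega
      · simp only [hj, hj', if_true, if_false]
        obtain ⟨h2, h3⟩ := hp.mem_columnsWith_iff.1 hj
        rcases eq_or_lt_of_le h1 with heq | hlt
        · -- Equal lengths: the entry `b` at the bottom of column `j` forces one in column `j'`.
          exfalso
          apply hj'
          rcases eq_or_lt_of_le hjj' with rfl | hlt'
          · exact hj
          rw [hp.mem_columnsWith_iff]
          refine ⟨by omega, ?_⟩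
          have h4 := hp.row (p.1 j' - 1) j j' hlt' (by omega)
          have h5 := hp.lt (p.1 j' - 1) j' (by omega)
          rw [heq] at h4 h5 ⊢
          omega
        · omega
    · simp only [hj, if_false]
      omega
  refine ⟨⟨hanti, ?_, ?_, ?_, ?_, ?_, ?_, ?_⟩, hbump, ?_⟩
  · intro j hj
    simp only [NCSchur.shrink, hp.zero j hj, Nat.zero_sub]
  · intro i j hij
    simp only [NCSchur.shrink] at hij ⊢
    split_ifs with h
    · rfl
    · refine hp.outside i j ?_
      by_cases hj : j ∈ columnsWith t b p
      · simp only [hj, if_true, true_and] at hij h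
        omega
      · simpa [hj] using hij
  · intro i j j' hjj' hi
    obtain ⟨h1, h2, -⟩ := hcell i j' hi
    obtain ⟨h3, h4, -⟩ := hcell i j (hi.trans_le (hanti hjj'.le))
    rw [h2, h4]
    exact hp.row i j j' hjj' h1
  · intro i i' j hii' hi'
    obtain ⟨h1, h2, -⟩ := hcell i' j hi'
    obtain ⟨h3, h4, -⟩ := hcell i j (hii'.trans hi')
    rw [h2, h4]
    exact hp.col i i' j hii' h1
  · intro i j hi
    obtain ⟨h1, h2, h3⟩ := hcell i j hi
    rwa [h2]
  · intro x hx
    rw [← hp.content x (hx.trans (Nat.lt_succ_self b))]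
    congr 1
    refine Finset.filter_congr fun j _ => ?_
    constructor
    · rintro ⟨i, hi, hij⟩
      obtain ⟨h1, h2, -⟩ := hcell i j hi
      exact ⟨i, h1, by rw [← h2, hij]⟩
    · rintro ⟨i, hi, hij⟩
      have h1 := hcell' i j hi (by omega)
      exact ⟨i, h1, by rw [(hcell i j h1).2.1, hij]⟩
  · have h1 := hp.size
    rw [← hbump, Finset.sum_range_succ, ← hp.content b (Nat.lt_succ_self b)] at h1
    simp only [bump, Finset.sum_add_distrib] at h1
    rw [Finset.sum_ite_mem, Finset.sum_const, smul_eq_mul, mul_one,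
      Finset.inter_eq_right.2 (show columnsWith t b p ⊆ Finset.range t from
        Finset.filter_subset _ _)] at h1
    exact Nat.add_right_cancel h1
  · refine Prod.ext hbump (funext fun i => funext fun j => ?_)
    simp only [NCSchur.grow]
    split_ifs with h
    · obtain ⟨hj, hi⟩ := h
      obtain ⟨h1, h2⟩ := hp.mem_columnsWith_iff.1 hj
      simp only [NCSchur.shrink, hj, if_true] at hi
      rw [hi, h2]
    · by_cases hj : j ∈ columnsWith t b p
      · simp only [NCSchur.shrink, hj, if_true, true_and] at h ⊢
        rw [if_neg]
        omega
      · simp [NCSchur.shrink, hj]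

end Grow

/-- A product of complete homogeneous symmetric functions is the sum, over the semistandard tableaux
of the corresponding content, of the Schur functions of their shapes. -/
theorem prod_complete_eq_sum {R : Type*} [CommRing R] (e : ℤ → R) (he0 : e 0 = 1)
    (he : ∀ k < 0, e k = 0) (h : ℕ → R) (h0 : h 0 = 1)
    (hrec : ∀ r, 0 < r → ∑ k ∈ Finset.range (r + 1), (-1) ^ k * e ((r : ℤ) - k) * h k = 0)
    (t : ℕ) (m : ℕ → ℕ) (b : ℕ) (hb : ∑ x ∈ Finset.range b, m x ≤ t) :
    ∃ 𝒮 : Finset ((ℕ → ℕ) × (ℕ → ℕ → ℕ)), (∀ p, p ∈ 𝒮 ↔ IsContentTab t b m p) ∧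
      ∏ x ∈ Finset.range b, h (m x) = ∑ p ∈ 𝒮, jacobiTrudi e t p.1 := by
  classical
  induction b with
  | zero =>
    refine ⟨{(0, 0)}, fun p => ?_, ?_⟩
    · rw [Finset.mem_singleton]
      constructor
      · rintro rfl
        exact ⟨fun _ _ _ => le_rfl, fun _ _ => rfl, fun _ _ _ => rfl, fun _ _ _ _ _ => le_rfl,
          fun _ _ _ _ hi => absurd hi (Nat.not_lt_zero _), fun _ _ hi => absurd hi (Nat.not_lt_zero _),
          fun _ hx => absurd hx (Nat.not_lt_zero _), by simp⟩
      · intro hp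
        have h1 : ∀ j, p.1 j = 0 := by
          intro j
          rcases lt_or_ge j t with hj | hj
          · exact Finset.sum_eq_zero_iff.1 (hp.size.trans (Finset.sum_range_zero _)) j
              (Finset.mem_range.2 hj)
          · exact hp.zero j hj
        refine Prod.ext (funext h1) (funext fun i => funext fun j => hp.outside i j ?_)
        rw [h1]
        exact Nat.zero_le _
    · rw [Finset.range_zero, Finset.prod_empty, Finset.sum_singleton, jacobiTrudi,
        Matrix.det_of_isUpperTriangular]
      · simp [he0]
      · intro i j hij
        rw [Matrix.of_apply]
        refine he _ ?_
        have : (j : ℕ) < i := hij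
        simp only [Pi.zero_apply]
        omega
  | succ b ih =>
    rw [Finset.sum_range_succ] at hb
    obtain ⟨𝒮, h𝒮, hsum⟩ := ih (by omega)
    refine ⟨((𝒮 ×ˢ (Finset.range t).powersetCard (m b)).filter
      (fun q => Antitone (bump q.1.1 q.2))).image (fun q => grow b q.1 q.2), fun p => ?_, ?_⟩
    · simp only [Finset.mem_image, Finset.mem_filter, Finset.mem_product, Finset.mem_powersetCard,
        Prod.exists]
      constructor
      · rintro ⟨α, T, S, ⟨⟨hp, hS, hcard⟩, hanti⟩, rfl⟩
        exact ((h𝒮 _).1 hp).grow hS hcard hanti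
      · intro hp
        obtain ⟨h1, h2, h3⟩ := hp.shrink
        refine ⟨(shrink t b p).1, (shrink t b p).2, columnsWith t b p,
          ⟨⟨(h𝒮 _).2 h1, Finset.filter_subset _ _, hp.content b (Nat.lt_succ_self b)⟩, ?_⟩, h3⟩
        have := hp.anti
        rwa [← h2] at this
    · rw [Finset.sum_image, Finset.sum_filter, Finset.sum_product, Finset.prod_range_succ, hsum,
        Finset.sum_mul]
      · refine Finset.sum_congr rfl fun p hp => ?_
        have hp' := (h𝒮 p).1 hp
        rw [mul_comm, ← jacobiTrudi_pieri e he0 he h h0 hrec (by omega : m b ≤ t) hp'.anti ?_,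
          Finset.sum_filter]
        · rfl
        · -- A tableau filling more than `t - m b` columns would have too many cells, the number of
          -- cells being the sum of the `m x` with `x < b`.
          intro i hi
          by_contra hne
          have h1 : ∑ j ∈ Finset.range (i + 1), 1 ≤ ∑ j ∈ Finset.range (i + 1), p.1 j := by
            refine Finset.sum_le_sum fun j hj => ?_
            have := hp'.anti (show j ≤ i by rw [Finset.mem_range] at hj; omega)
            omega
          have hit : i < t := by
            by_contra hc
            exact hne (hp'.zero i (by omega))
          have h2 : ∑ j ∈ Finset.range (i + 1), p.1 j ≤ ∑ j ∈ Finset.range t, p.1 j :=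
            Finset.sum_le_sum_of_subset (Finset.range_subset_range.2 hit)
          rw [hp'.size] at h2
          simp only [Finset.sum_const, Finset.card_range, smul_eq_mul, mul_one] at h1
          omega
      · intro q hq q' hq' hqq'
        simp only [Finset.coe_filter, Set.mem_ofPred_eq, Finset.mem_product,
          Finset.mem_powersetCard] at hq hq'
        have k1 := ((h𝒮 _).1 hq.1.1)
        have k2 := ((h𝒮 _).1 hq'.1.1)
        refine Prod.ext ?_ ?_
        · rw [← k1.shrink_grow hq.1.2.1, ← k2.shrink_grow hq'.1.2.1]
          exact congrArg (shrink t b) hqq'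
        · rw [← k1.columnsWith_grow hq.1.2.1, ← k2.columnsWith_grow hq'.1.2.1]
          exact congrArg (columnsWith t b) hqq'

/-! ### The generating functions of the elementary and complete homogeneous functions -/

/-- The complete homogeneous symmetric function of the first `m` letters. -/
noncomputable def hLetters (N m k : ℕ) : U N :=
  ∑ f ∈ Finset.univ.filter (fun f : Fin k → Fin N => Monotone f ∧ ∀ i, (f i : ℕ) < m),
    mon (List.ofFn f)

theorem hLetters_self (N k : ℕ) : hLetters N N k = h N k := by
  rw [hLetters, h]
  refine Finset.sum_congr (Finset.ext fun f => ?_) fun _ _ => rfl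
  simp

theorem hLetters_zero_right (N m : ℕ) : hLetters N m 0 = 1 := by
  have : (Finset.univ.filter fun f : Fin 0 → Fin N => Monotone f ∧ ∀ i, (f i : ℕ) < m) =
      {default} := by
    ext f
    simp only [Finset.mem_filter, Finset.mem_univ, true_and, Finset.mem_singleton]
    exact ⟨fun _ => Subsingleton.elim _ _, fun _ => ⟨fun a => a.elim0, fun a => a.elim0⟩⟩
  rw [hLetters, this]
  simp [mon]

theorem hLetters_zero_left (N k : ℕ) : hLetters N 0 (k + 1) = 0 := by
  rw [hLetters, Finset.filter_false_of_mem, Finset.sum_empty]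
  intro f _ hf
  exact absurd (hf.2 0) (Nat.not_lt_zero _)

theorem hLetters_succ (N m k : ℕ) (hm : m < N) :
    hLetters N (m + 1) (k + 1) = hLetters N m (k + 1) + hLetters N (m + 1) k * u ⟨m, hm⟩ := by
  classical
  rw [hLetters, ← Finset.sum_filter_add_sum_filter_not _
    fun f : Fin (k + 1) → Fin N => (f (Fin.last k) : ℕ) < m]
  congr 1
  · rw [hLetters]
    refine Finset.sum_congr ?_ fun _ _ => rfl
    ext f
    simp only [Finset.mem_filter, Finset.mem_univ, true_and]
    constructor
    · rintro ⟨⟨h1, _⟩, h3⟩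
      exact ⟨h1, fun i => lt_of_le_of_lt (Fin.le_def.1 (h1 (Fin.le_last i))) h3⟩
    · rintro ⟨h1, h2⟩
      exact ⟨⟨h1, fun i => (h2 i).trans (Nat.lt_succ_self m)⟩, h2 _⟩
  · rw [hLetters, Finset.sum_mul]
    symm
    refine Finset.sum_bij
      (fun (f : Fin k → Fin N) _ => (Fin.snoc f ⟨m, hm⟩ : Fin (k + 1) → Fin N)) ?_ ?_ ?_ ?_
    · intro f hf
      simp only [Finset.mem_filter, Finset.mem_univ, true_and] at hf ⊢
      obtain ⟨h1, h2⟩ := hf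
      refine ⟨⟨?_, ?_⟩, by simp⟩
      · intro i j
        induction j using Fin.lastCases with
        | last =>
          intro _
          induction i using Fin.lastCases with
          | last => exact le_rfl
          | cast i =>
            rw [Fin.snoc_last, Fin.snoc_castSucc, Fin.le_def]
            exact Nat.le_of_lt_succ (h2 i)
        | cast j =>
          intro hij
          induction i using Fin.lastCases with
          | last => exact absurd hij (not_le_of_gt (Fin.castSucc_lt_last j))
          | cast i =>
            rw [Fin.snoc_castSucc, Fin.snoc_castSucc]
            exact h1 (by simpa using hij)
      · intro i
        induction i using Fin.lastCases with
        | last => rw [Fin.snoc_last]; exact Nat.lt_succ_self m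
        | cast i => rw [Fin.snoc_castSucc]; exact h2 i
    · intro f _ g _ hfg
      funext i
      have := congrFun hfg i.castSucc
      simpa using this
    · intro g hg
      simp only [Finset.mem_filter, Finset.mem_univ, true_and] at hg
      obtain ⟨⟨h1, h2⟩, h3⟩ := hg
      refine ⟨fun i => g i.castSucc, ?_, ?_⟩
      · simp only [Finset.mem_filter, Finset.mem_univ, true_and]
        exact ⟨fun i j hij => h1 (by simpa using hij), fun i => h2 _⟩
      · funext i
        induction i using Fin.lastCases with
        | last =>
          rw [Fin.snoc_last]
          ext
          have := h2 (Fin.last k)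
          simp only
          omega
        | cast i => rw [Fin.snoc_castSucc]
    · intro f _
      rw [List.ofFn_succ']
      simp [mon]

open PowerSeries in
/-- The generating functions `∑ h_k x^k` and `∑ (-1)^k e_k x^k` are inverse to each other. -/
theorem mk_hLetters_mul_mk_e (N m : ℕ) (hm : m ≤ N) :
    (PowerSeries.mk fun k => hLetters N m k) *
      (PowerSeries.mk fun k => (-1) ^ k * e (letters N m) (k : ℤ)) = 1 := by
  induction m with
  | zero =>
    have h1 : (PowerSeries.mk fun k => hLetters N 0 k) = 1 := by
      ext k
      cases k with
      | zero => simp [hLetters_zero_right]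
      | succ k => simp [hLetters_zero_left, coeff_one]
    have h2 : (PowerSeries.mk fun k => (-1) ^ k * e (letters N 0) (k : ℤ)) = 1 := by
      have h0 : letters N 0 = ∅ := by simp [letters]
      ext k
      cases k with
      | zero => simp [e_zero]
      | succ k =>
        rw [coeff_mk, coeff_one, if_neg (by omega), h0, e, if_pos (by omega),
          Finset.powersetCard_eq_empty.2, Finset.sum_empty, mul_zero]
        rw [Finset.card_empty]
        omega
    rw [h1, h2, one_mul]
  | succ m ih =>
    have hm' : m < N := hm
    set x : U N := u ⟨m, hm'⟩ with hx
    have hins : letters N (m + 1) = insert ⟨m, hm'⟩ (letters N m) := by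
      ext a
      simp only [letters, Finset.mem_filter, Finset.mem_univ, true_and, Finset.mem_insert, Fin.ext_iff]
      omega
    have h1 : (PowerSeries.mk fun k => hLetters N (m + 1) k) * (1 - C x * X) =
        PowerSeries.mk fun k => hLetters N m k := by
      rw [mul_sub, mul_one, ← mul_assoc]
      ext k
      rw [map_sub, coeff_mk, coeff_mk]
      cases k with
      | zero => simp [hLetters_zero_right]
      | succ k =>
        rw [coeff_succ_mul_X, coeff_mul_C, coeff_mk, hLetters_succ N m k hm', add_sub_cancel_right]
    have h2 : (PowerSeries.mk fun k => (-1) ^ k * e (letters N (m + 1)) (k : ℤ)) =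
        (1 - C x * X) * PowerSeries.mk fun k => (-1) ^ k * e (letters N m) (k : ℤ) := by
      rw [sub_mul, one_mul, mul_assoc]
      ext k
      rw [map_sub, coeff_mk, coeff_mk, coeff_C_mul, hins,
        e_insert _ _ (by simp [letters, Fin.lt_def])]
      cases k with
      | zero => simp [e_of_neg]
      | succ k =>
        rw [coeff_succ_X_mul, coeff_mk, mul_add, sub_eq_add_neg (_ * _)]
        congr 1
        rw [pow_succ, ← mul_assoc, ← mul_assoc]
        have : ((k + 1 : ℕ) : ℤ) - 1 = k := by push_cast; ring
        rw [this]
        have hc : Commute ((-1 : U N) ^ k) x := (Commute.neg_one_left x).pow_left k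
        rw [mul_neg_one, neg_mul, neg_mul, hc.eq]
    rw [h2, ← mul_assoc, h1, ih (by omega)]

open scoped IsMulCommutative in
/-- Commuting elements lie in the image of a commutative ring. -/
theorem exists_commRing_lift.{w} {A : Type w} [Ring A] (E : ℤ → A) (hE : ∀ k l, E k * E l = E l * E k)
    (h0 : E 0 = 1) (hneg : ∀ k < 0, E k = 0) :
    ∃ (R : Type w) (_ : CommRing R) (φ : R →+* A) (e' : ℤ → R),
      (∀ k, φ (e' k) = E k) ∧ e' 0 = 1 ∧ ∀ k < 0, e' k = 0 := by
  have hcomm : ∀ x ∈ Set.range E, ∀ y ∈ Set.range E, x * y = y * x := by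
    rintro _ ⟨k, rfl⟩ _ ⟨l, rfl⟩
    exact hE k l
  have := Subring.isMulCommutative_closure hcomm
  refine ⟨Subring.closure (Set.range E), inferInstance,
    (Subring.closure (Set.range E)).subtype,
    fun k => ⟨E k, Subring.subset_closure ⟨k, rfl⟩⟩, fun k => rfl, ?_, ?_⟩
  · exact Subtype.ext h0
  · exact fun k hk => Subtype.ext (hneg k hk)

theorem map_jacobiTrudi {A R : Type*} [Ring A] [CommRing R] (φ : R →+* A) (e' : ℤ → R) (v : ℕ → A)
    (N : ℕ) (he : ∀ k, φ (e' k) = elem v N k) (t : ℕ) (α : ℕ → ℕ) :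
    φ (jacobiTrudi e' t α) = ndet t (flagCol v α fun _ => N) := by
  rw [jacobiTrudi, ← Matrix.det_transpose, Matrix.det_apply, map_sum, ndet]
  refine Finset.sum_congr rfl fun π _ => ?_
  rw [Units.smul_def, map_zsmul, ← List.prod_ofFn, map_list_prod, List.map_ofFn]
  congr 3
  funext j
  rw [Function.comp_apply, Matrix.transpose_apply, Matrix.of_apply, he, flagCol]
  congr 1
  ring

/-- The Schur function of the diagram with at most `t` columns of lengths `α`; empty columns do not
matter, so that one `t` serves all diagrams with at most `t` cells. -/
noncomputable def schurOfCols (N t : ℕ) (α : ℕ → ℕ) : U N :=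
  flaggedSchur N (fun j : Fin t => α j) fun _ => N

/-- The noncommutative Cauchy identity: the coefficients of the Cauchy product are, modulo the
ideal, sums of noncommutative Schur functions over the semistandard tableaux of given content. -/
theorem toQuot_cauchyProduct (N : ℕ) (m : ℕ →₀ ℕ) :
    ∃ 𝒮 : Finset ((ℕ → ℕ) × (ℕ → ℕ → ℕ)),
      (∀ p, p ∈ 𝒮 ↔ IsContentTab (∑ x ∈ Finset.range (m.support.sup Nat.succ), m x)
        (m.support.sup Nat.succ) m p) ∧
      toQuot N (cauchyProduct N m) = toQuot N (∑ p ∈ 𝒮,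
        schurOfCols N (∑ x ∈ Finset.range (m.support.sup Nat.succ), m x) p.1) := by
  set K := m.support.sup Nat.succ with hK
  set t := ∑ x ∈ Finset.range K, m x with ht
  obtain ⟨R, _, φ, e', he', he0, hneg⟩ := exists_commRing_lift (fun k => elem (letter N) N k)
    (elem_mul_comm (satisfiesB_letter N) N) (elem_zero_right _ _) fun k hk => elem_of_neg _ _ k hk
  let E : PowerSeries R := PowerSeries.mk fun k => (-1) ^ k * e' k
  have hEc : PowerSeries.constantCoeff E = ((1 : Rˣ) : R) := by
    rw [← PowerSeries.coeff_zero_eq_constantCoeff_apply, PowerSeries.coeff_mk]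
    simp [he0]
  let H' : PowerSeries R := PowerSeries.invOfUnit E 1
  let h' : ℕ → R := fun k => PowerSeries.coeff k H'
  have hHE : H' * E = 1 := PowerSeries.invOfUnit_mul E 1 hEc
  have hEH : E * H' = 1 := PowerSeries.mul_invOfUnit E 1 hEc
  have h'0 : h' 0 = 1 := by
    simp only [h', PowerSeries.coeff_zero_eq_constantCoeff_apply, H']
    rw [PowerSeries.constantCoeff_invOfUnit]
    simp
  have hrec : ∀ r, 0 < r →
      ∑ k ∈ Finset.range (r + 1), (-1) ^ k * e' ((r : ℤ) - k) * h' k = 0 := by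
    intro r hr
    have h1 := congrArg (PowerSeries.coeff r) hHE
    rw [PowerSeries.coeff_mul, PowerSeries.coeff_one, if_neg hr.ne',
      Finset.Nat.sum_antidiagonal_eq_sum_range_succ_mk] at h1
    have h2 := congrArg (fun x => (-1) ^ r * x) h1
    simp only [mul_zero, Finset.mul_sum] at h2
    rw [← h2]
    refine Finset.sum_congr rfl fun k hk => ?_
    rw [Finset.mem_range] at hk
    rw [PowerSeries.coeff_mk, Nat.cast_sub (by omega)]
    have h4 : (-1 : R) ^ r = (-1) ^ k * (-1) ^ (r - k) := by
      rw [← pow_add]; congr 1; omega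
    have h5 : (-1 : R) ^ (r - k) * (-1) ^ (r - k) = 1 := by
      rw [← mul_pow]; simp
    rw [h4]
    change _ = (-1) ^ k * (-1) ^ (r - k) * (h' k * ((-1) ^ (r - k) * e' ((r : ℤ) - k)))
    linear_combination (-(-1) ^ k * e' ((r : ℤ) - k) * h' k) * h5
  -- The image of `h'` is the sequence of the complete homogeneous functions.
  have hφ : ∀ k, φ (h' k) = toQuot N (h N k) := by
    have h1 : PowerSeries.map φ E =
        PowerSeries.map (toQuot N) (PowerSeries.mk fun k => (-1) ^ k * e (letters N N) (k : ℤ)) := by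
      ext k
      simp only [E, PowerSeries.coeff_map, PowerSeries.coeff_mk, map_mul, map_pow, map_neg, map_one,
        he', toQuot_e N N le_rfl]
    have h2 := congrArg (PowerSeries.map (toQuot N)) (mk_hLetters_mul_mk_e N N le_rfl)
    rw [map_mul, ← h1, map_one] at h2
    have h3 : PowerSeries.map φ E * PowerSeries.map φ H' = 1 := by
      rw [← map_mul, hEH, map_one]
    have h4 := left_inv_eq_right_inv h2 h3
    intro k
    have h5 := congrArg (PowerSeries.coeff k) h4
    rw [PowerSeries.coeff_map, PowerSeries.coeff_map, PowerSeries.coeff_mk, hLetters_self] at h5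
    exact h5.symm
  obtain ⟨𝒮, h𝒮, hsum⟩ := prod_complete_eq_sum e' he0 hneg h' h'0 hrec t m K le_rfl
  refine ⟨𝒮, h𝒮, ?_⟩
  have h1 := congrArg φ hsum
  have h2 : φ (∏ x ∈ Finset.range K, h' (m x)) = toQuot N (cauchyProduct N m) := by
    have : ∏ x ∈ Finset.range K, h' (m x) = ((List.range K).map fun x => h' (m x)).prod := rfl
    rw [this, map_list_prod, cauchyProduct, map_list_prod, List.map_map, List.map_map]
    congr 1
    exact List.map_congr_left fun x _ => hφ _
  rw [← h2, h1, map_sum, map_sum]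
  refine Finset.sum_congr rfl fun p _ => ?_
  rw [map_jacobiTrudi φ e' (letter N) N he', schurOfCols, toQuot_flaggedSchur N _ _ fun _ => le_rfl]
  refine ndet_congr fun j hj q _ => ?_
  rw [flagCol, flagCol, extendZero_of_lt _ hj, extendZero_of_lt _ hj]

/-! ### The pairing -/

theorem wordCoeff_mon {N : ℕ} (v w : List (Fin N)) :
    wordCoeff (mon v) w = if v = w then 1 else 0 := by
  rw [← pairing_mon, pairing, Finsupp.sum_single_index (by simp), mul_one]

theorem wordCoeff_add {N : ℕ} (f g : U N) (w : List (Fin N)) :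
    wordCoeff (f + g) w = wordCoeff f w + wordCoeff g w := by
  simp [wordCoeff]

/-- The pairing with `γ`, as an additive map. -/
noncomputable def pairingHom {N : ℕ} (γ : UStar N) : U N →+ ℤ :=
  AddMonoidHom.mk' (fun f => pairing f γ) fun f g => by
    simp only [pairing, Finsupp.sum, wordCoeff_add, add_mul, Finset.sum_add_distrib]

theorem pairingHom_apply {N : ℕ} (γ : UStar N) (f : U N) : pairingHom γ f = pairing f γ := rfl

theorem pairing_mon_eq {N : ℕ} (v : List (Fin N)) (γ : UStar N) : pairing (mon v) γ = γ v := by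
  rw [pairing, Finsupp.sum_eq_single v]
  · rw [wordCoeff_mon, if_pos rfl, one_mul]
  · intro w _ hw
    rw [wordCoeff_mon, if_neg hw.symm, zero_mul]
  · simp

theorem pairing_eq_of_toQuot_eq {N : ℕ} {γ : UStar N} (hγ : IsOrthogonal (idealB N) γ) {f g : U N}
    (hfg : toQuot N f = toQuot N g) : pairing f γ = pairing g γ := by
  have := hγ _ ((toQuot_eq_iff f g).1 hfg)
  rw [← pairingHom_apply, map_sub, sub_eq_zero] at this
  exact this

/-! ### Schur positivity -/

theorem length_filterMap_range (l : ℕ) (P : ℕ → Prop) [DecidablePred P] (g : ℕ → ℕ) :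
    ((List.range l).filterMap fun j => if P j then some (g j) else none).length =
      ∑ j ∈ Finset.range l, if P j then 1 else 0 := by
  induction l with
  | zero => rfl
  | succ l ih =>
    rw [List.range_succ, List.filterMap_append, List.length_append, ih, Finset.sum_range_succ]
    congr 1
    split_ifs with h <;> simp [h]

theorem length_flatMap_range (D : ℕ) (f : ℕ → List ℕ) :
    ((List.range D).flatMap f).length = ∑ d ∈ Finset.range D, (f d).length := by
  induction D with
  | zero => rfl
  | succ D ih =>
    rw [List.range_succ, List.flatMap_append, List.length_append, ih, Finset.sum_range_succ,
      List.flatMap_singleton]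

/-- The diagonal reading word contains every cell once. -/
theorem length_diagread {N l : ℕ} {α : Fin l → ℕ} (T : Filling N α) :
    (diagread T).length = ∑ j, α j := by
  set R := Finset.univ.sup α with hR
  rw [← List.length_map (f := Fin.val), map_val_diagread, ← List.range_eq_range',
    length_flatMap_range]
  simp only [diagList, length_filterMap_range]
  rw [Finset.sum_comm, ← Fin.sum_univ_eq_sum_range
    (fun j => ∑ d ∈ Finset.range (R + l), if d ≤ j + R ∧ j + R - d < extendZero α j then 1 else 0)]
  refine Finset.sum_congr rfl fun j _ => ?_
  rw [extendZero_apply, ← Finset.card_filter]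
  have hle : α j ≤ R := Finset.le_sup (Finset.mem_univ j)
  have : ((Finset.range (R + l)).filter fun d => d ≤ j + R ∧ j + R - d < α j) =
      (Finset.range (α j)).image fun i => j + R - i := by
    ext d
    simp only [Finset.mem_filter, Finset.mem_range, Finset.mem_image]
    constructor
    · rintro ⟨_, h1, h2⟩
      exact ⟨j + R - d, h2, by omega⟩
    · rintro ⟨i, hi, rfl⟩
      have := j.2
      omega
  rw [this, Finset.card_image_of_injOn, Finset.card_range]
  intro i hi i' hi' hii'
  simp only [Finset.coe_range, Set.mem_Iio] at hi hi' hii'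
  omega

theorem lt_card_of_mem {μ : YoungDiagram} {i j : ℕ} (hij : (i, j) ∈ μ) : i < μ.card ∧ j < μ.card := by
  constructor
  · have : (Finset.range (i + 1)).image (fun k => (k, j)) ⊆ μ.cells := by
      intro c hc
      obtain ⟨k, hk, rfl⟩ := Finset.mem_image.1 hc
      exact μ.up_left_mem (by rw [Finset.mem_range] at hk; omega) le_rfl hij
    have := Finset.card_le_card this
    rwa [Finset.card_image_of_injective _ (fun a b hab => (Prod.ext_iff.1 hab).1),
      Finset.card_range] at this
  · have : (Finset.range (j + 1)).image (fun k => (i, k)) ⊆ μ.cells := by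
      intro c hc
      obtain ⟨k, hk, rfl⟩ := Finset.mem_image.1 hc
      exact μ.up_left_mem le_rfl (by rw [Finset.mem_range] at hk; omega) hij
    have := Finset.card_le_card this
    rwa [Finset.card_image_of_injective _ (fun a b hab => (Prod.ext_iff.1 hab).2),
      Finset.card_range] at this

theorem finite_card_le (L : ℕ) : {μ : YoungDiagram | μ.card ≤ L}.Finite := by
  refine Set.Finite.of_finite_image (f := YoungDiagram.cells) ?_ ?_
  · refine Set.Finite.subset (Finset.finite_toSet (Finset.range L ×ˢ Finset.range L).powerset) ?_
    rintro _ ⟨μ, hμ, rfl⟩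
    rw [Finset.mem_coe, Finset.mem_powerset]
    rintro ⟨i, j⟩ hij
    have h1 := lt_card_of_mem hij
    have h2 : μ.card ≤ L := hμ
    rw [Finset.mem_product, Finset.mem_range, Finset.mem_range]
    exact ⟨h1.1.trans_le h2, h1.2.trans_le h2⟩
  · intro μ _ ν _ h
    exact YoungDiagram.ext h

theorem colLen_eq_zero {μ : YoungDiagram} {j : ℕ} (hj : μ.card ≤ j) : μ.colLen j = 0 := by
  by_contra h
  have := (lt_card_of_mem (YoungDiagram.mem_iff_lt_colLen.2 (Nat.pos_of_ne_zero h))).2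
  omega

theorem sum_colLen {μ : YoungDiagram} {t : ℕ} (ht : ∀ j, t ≤ j → μ.colLen j = 0) :
    ∑ j ∈ Finset.range t, μ.colLen j = μ.card := by
  have hmaps : (μ.cells : Set (ℕ × ℕ)).MapsTo Prod.snd (Finset.range t) := by
    rintro ⟨i, j⟩ hij
    rw [Finset.mem_coe, Finset.mem_range]
    by_contra hc
    have h1 := YoungDiagram.mem_iff_lt_colLen.1 hij
    rw [ht j (by simpa using hc)] at h1
    exact absurd h1 (Nat.not_lt_zero _)
  rw [YoungDiagram.card, Finset.card_eq_sum_card_fiberwise hmaps]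
  refine Finset.sum_congr rfl fun j _ => ?_
  rw [YoungDiagram.colLen_eq_card]
  rfl

theorem card_columns_eq_card_cells {μ : YoungDiagram} (T : SemistandardYoungTableau μ) {t : ℕ}
    (ht : ∀ j, t ≤ j → μ.colLen j = 0) (x : ℕ) :
    ((Finset.range t).filter fun j => ∃ i < μ.colLen j, T i j = x).card =
      (μ.cells.filter fun c => T c.1 c.2 = x).card := by
  have : ((Finset.range t).filter fun j => ∃ i < μ.colLen j, T i j = x) =
      (μ.cells.filter fun c => T c.1 c.2 = x).image Prod.snd := by
    ext j
    simp only [Finset.mem_filter, Finset.mem_range, Finset.mem_image, YoungDiagram.mem_cells,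
      Prod.exists, exists_eq_right, YoungDiagram.mem_iff_lt_colLen]
    refine ⟨And.right, fun hj => ⟨?_, hj⟩⟩
    by_contra hc
    obtain ⟨i, hi, _⟩ := hj
    rw [ht j (by omega)] at hi
    exact absurd hi (Nat.not_lt_zero _)
  rw [this, Finset.card_image_of_injOn]
  rintro ⟨i, j⟩ hij ⟨i', j'⟩ hij' h
  simp only [Finset.coe_filter, Set.mem_ofPred_eq, YoungDiagram.mem_cells] at hij hij' h
  subst h
  rcases lt_trichotomy i i' with hlt | rfl | hlt
  · have := T.col_strict hlt hij'.1
    omega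
  · rfl
  · have := T.col_strict hlt hij.1
    omega

/-- A semistandard Young tableau with the content given by `m`, viewed as a pair of its column
lengths and its entries. -/
theorem isContentTab_iff {μ : YoungDiagram} (T : SemistandardYoungTableau μ) (m : ℕ →₀ ℕ) (K : ℕ)
    (hK : ∀ x, K ≤ x → m x = 0) :
    IsContentTab (∑ x ∈ Finset.range K, m x) K m (μ.colLen, fun i j => T i j) ↔
      ∀ i, (μ.cells.filter fun c => T c.1 c.2 = i).card = m i := by
  constructor
  · intro h i
    rcases lt_or_ge i K with hi | hi
    · rw [← card_columns_eq_card_cells T h.zero]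
      exact h.content i hi
    · rw [hK i hi, Finset.card_eq_zero, Finset.filter_eq_empty_iff]
      rintro ⟨a, b⟩ hab hc
      have := h.lt a b (YoungDiagram.mem_iff_lt_colLen.1 hab)
      simp only at this hc
      omega
  · intro h
    have hlt : ∀ i j, (i, j) ∈ μ → T i j < K := by
      intro i j hij
      by_contra hc
      have h1 := h (T i j)
      rw [hK _ (by omega), Finset.card_eq_zero, Finset.filter_eq_empty_iff] at h1
      exact h1 hij rfl
    have hcard : μ.card = ∑ x ∈ Finset.range K, m x := by
      rw [YoungDiagram.card, Finset.card_eq_sum_card_fiberwise (f := fun c => T c.1 c.2)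
        (t := Finset.range K)]
      · exact Finset.sum_congr rfl fun x _ => h x
      · rintro ⟨i, j⟩ hij
        rw [Finset.mem_coe, Finset.mem_range]
        exact hlt i j hij
    have hzero : ∀ j, ∑ x ∈ Finset.range K, m x ≤ j → μ.colLen j = 0 := fun j hj =>
      colLen_eq_zero (by omega)
    exact ⟨fun j j' hjj' => μ.colLen_anti j j' hjj', hzero,
      fun i j hij => T.zeros fun hc => by
        have := YoungDiagram.mem_iff_lt_colLen.1 hc
        simp only at hij
        omega,
      fun i j j' hjj' hi => T.row_weak hjj' (YoungDiagram.mem_iff_lt_colLen.2 hi),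
      fun i i' j hii' hi => T.col_strict hii' (YoungDiagram.mem_iff_lt_colLen.2 hi),
      fun i j hi => hlt i j (YoungDiagram.mem_iff_lt_colLen.2 hi),
      fun x _ => (card_columns_eq_card_cells T hzero x).trans (h x),
      (sum_colLen hzero).trans hcard⟩

/-- The coefficients of Schur functions count tableaux. -/
theorem schur_eq_card {μ : YoungDiagram} (m : ℕ →₀ ℕ) (K : ℕ) (hK : ∀ x, K ≤ x → m x = 0)
    (𝒮 : Finset ((ℕ → ℕ) × (ℕ → ℕ → ℕ)))
    (h𝒮 : ∀ p, p ∈ 𝒮 ↔ IsContentTab (∑ x ∈ Finset.range K, m x) K m p)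
    [DecidablePred fun p : (ℕ → ℕ) × (ℕ → ℕ → ℕ) => p.1 = μ.colLen] :
    schur μ m = ((𝒮.filter fun p => p.1 = μ.colLen).card : ℤ) := by
  rw [schur, ← Nat.card_eq_finsetCard]
  congr 1
  refine Nat.card_congr (Equiv.ofBijective (fun T => ⟨(μ.colLen, fun i j => T.1 i j), ?_⟩) ⟨?_, ?_⟩)
  · rw [Finset.mem_filter, h𝒮, isContentTab_iff T.1 m K hK]
    exact ⟨T.2, rfl⟩
  · intro T T' hTT'
    have h1 := congrArg (fun p => p.1.2) hTT'
    refine Subtype.ext (SemistandardYoungTableau.ext fun i j => ?_)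
    exact congrFun (congrFun h1 i) j
  · rintro ⟨⟨α, T⟩, hp⟩
    obtain ⟨hp, rfl⟩ := Finset.mem_filter.1 hp
    have hp' := (h𝒮 _).1 hp
    let S : SemistandardYoungTableau μ :=
      { entry := T
        row_weak' := fun hj hc => hp'.row _ _ _ hj (YoungDiagram.mem_iff_lt_colLen.1 hc)
        col_strict' := fun hi hc => hp'.col _ _ _ hi (YoungDiagram.mem_iff_lt_colLen.1 hc)
        zeros' := fun hc => hp'.outside _ _ (by
          rw [YoungDiagram.mem_iff_lt_colLen] at hc
          simpa using hc) }
    refine ⟨⟨S, ?_⟩, rfl⟩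
    rw [← isContentTab_iff S m K hK]
    exact hp'

/-- Every weakly decreasing sequence of column lengths is that of a Young diagram. -/
theorem exists_colLen_eq {α : ℕ → ℕ} (hα : Antitone α) {t : ℕ} (ht : ∀ j, t ≤ j → α j = 0) :
    ∃ μ : YoungDiagram, μ.colLen = α := by
  have hmem : ∀ i j, (i, j) ∈ ((Finset.range (α 0) ×ˢ Finset.range t).filter fun c => c.1 < α c.2) ↔
      i < α j := by
    intro i j
    simp only [Finset.mem_filter, Finset.mem_product, Finset.mem_range]
    refine ⟨And.right, fun h => ⟨⟨h.trans_le (hα (Nat.zero_le j)), ?_⟩, h⟩⟩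
    by_contra hc
    rw [ht j (by omega)] at h
    exact absurd h (Nat.not_lt_zero _)
  let μ : YoungDiagram :=
    ⟨(Finset.range (α 0) ×ˢ Finset.range t).filter fun c => c.1 < α c.2, by
      rintro ⟨i, j⟩ ⟨i', j'⟩ hle h
      rw [Finset.mem_coe, hmem] at h ⊢
      have h1 : i' ≤ i := hle.1
      have h2 := hα (show j' ≤ j from hle.2)
      omega⟩
  refine ⟨μ, funext fun j => ?_⟩
  have h1 : ∀ i, i < μ.colLen j ↔ i < α j := fun i =>
    YoungDiagram.mem_iff_lt_colLen.symm.trans (hmem i j)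
  exact eq_of_forall_lt_iff h1

/-- The coefficient of `s_μ` in the symmetric function of `γ`. -/
noncomputable def schurCoeff {N : ℕ} (γ : UStar N) (μ : YoungDiagram) : ℤ :=
  pairing (schurOfCols N μ.card μ.colLen) γ

section Positivity

variable {N : ℕ} {γ : UStar N}

theorem schurCoeff_eq_sum (hγ : IsOrthogonal (idealB N) γ) (μ : YoungDiagram) :
    schurCoeff γ μ =
      ∑ T ∈ flaggedSSYT N (fun j : Fin μ.card => μ.colLen j) (fun _ => N), γ (diagread T) := by
  rw [schurCoeff, schurOfCols, pairing_eq_of_toQuot_eq hγ (toQuot_flaggedSchur_eq_sum N _ _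
    (fun j k hjk => (μ.colLen_anti j k (by omega)).trans (Nat.le_succ _)) (fun _ _ _ => le_rfl)
    fun _ => le_rfl), ← pairingHom_apply, map_sum]
  exact Finset.sum_congr rfl fun T _ => pairing_mon_eq _ γ

theorem schurCoeff_nonneg (hγ : IsOrthogonal (idealB N) γ) (hpos : IsNonneg γ) (μ : YoungDiagram) :
    0 ≤ schurCoeff γ μ := by
  rw [schurCoeff_eq_sum hγ]
  exact Finset.sum_nonneg fun T _ => hpos _

theorem schurCoeff_eq_zero (hγ : IsOrthogonal (idealB N) γ) (μ : YoungDiagram)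
    (hμ : γ.support.sup List.length < μ.card) : schurCoeff γ μ = 0 := by
  rw [schurCoeff_eq_sum hγ]
  refine Finset.sum_eq_zero fun T _ => ?_
  by_contra hc
  have h1 : (diagread T).length ≤ γ.support.sup List.length :=
    Finset.le_sup (Finsupp.mem_support_iff.2 hc)
  rw [length_diagread, Fin.sum_univ_eq_sum_range (fun j => μ.colLen j),
    sum_colLen fun j hj => colLen_eq_zero hj] at h1
  omega

/-- The symmetric function of a nonnegative `γ` orthogonal to the ideal is Schur positive: pair
the Cauchy identity with `γ`. -/
theorem isSchurPositive_F (hpos : IsNonneg γ) (hγ : IsOrthogonal (idealB N) γ) :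
    IsSchurPositive (F γ) := by
  classical
  set Λ := (finite_card_le (γ.support.sup List.length)).toFinset with hΛ
  have hmemΛ : ∀ μ, μ ∉ Λ → schurCoeff γ μ = 0 := by
    intro μ hμ
    refine schurCoeff_eq_zero hγ μ ?_
    simpa [hΛ] using hμ
  refine ⟨Finsupp.onFinset Λ (fun μ => (schurCoeff γ μ).toNat) fun μ hμ => ?_, ?_⟩
  · by_contra hc
    rw [hmemΛ μ hc] at hμ
    exact hμ rfl
  rw [Finsupp.onFinset_sum (g := fun μ k => k • schur μ) _ (fun μ => zero_smul ℕ _)]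
  funext m
  set K := m.support.sup Nat.succ with hKdef
  have hK : ∀ x, K ≤ x → m x = 0 := by
    intro x hx
    by_contra hc
    have : Nat.succ x ≤ K := Finset.le_sup (Finsupp.mem_support_iff.2 hc)
    omega
  obtain ⟨𝒮, h𝒮, hsum⟩ := toQuot_cauchyProduct N m
  rw [← hKdef] at h𝒮 hsum
  set t := ∑ x ∈ Finset.range K, m x with ht
  have h1 : F γ m = ∑ p ∈ 𝒮, pairing (schurOfCols N t p.1) γ := by
    rw [F, pairing_eq_of_toQuot_eq hγ hsum, ← pairingHom_apply, map_sum]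
    rfl
  have hshape : ∀ p ∈ 𝒮, ∃ μ : YoungDiagram, μ.colLen = p.1 ∧ μ.card = t := by
    intro p hp
    have hp' := (h𝒮 p).1 hp
    obtain ⟨μ, hμ⟩ := exists_colLen_eq hp'.anti hp'.zero
    refine ⟨μ, hμ, ?_⟩
    rw [← sum_colLen (t := t) (by rw [hμ]; exact hp'.zero), hμ]
    exact hp'.size
  have hinj : ∀ μ ν : YoungDiagram, μ.colLen = ν.colLen → μ = ν := by
    intro μ ν hμν
    refine YoungDiagram.ext (Finset.ext fun ⟨i, j⟩ => ?_)
    rw [YoungDiagram.mem_cells, YoungDiagram.mem_cells, YoungDiagram.mem_iff_lt_colLen,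
      YoungDiagram.mem_iff_lt_colLen, hμν]
  have h2 : ∀ p ∈ 𝒮, pairing (schurOfCols N t p.1) γ =
      ∑ μ ∈ Λ, if p.1 = μ.colLen then schurCoeff γ μ else 0 := by
    intro p hp
    obtain ⟨μ, hμ, hcard⟩ := hshape p hp
    have h3 : pairing (schurOfCols N t p.1) γ = schurCoeff γ μ := by
      rw [schurCoeff, hμ, hcard]
    rw [h3, Finset.sum_eq_single μ]
    · rw [if_pos hμ.symm]
    · intro ν _ hν
      rw [if_neg]
      intro hc
      exact hν (hinj _ _ (hc.symm.trans hμ.symm))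
    · intro hc
      rw [hmemΛ μ hc, ite_self]
  rw [h1, Finset.sum_congr rfl h2, Finset.sum_comm]
  refine Eq.trans ?_ (map_sum (MvPowerSeries.coeff m)
    (fun μ => (schurCoeff γ μ).toNat • schur μ) Λ).symm
  refine Finset.sum_congr rfl fun μ _ => ?_
  rw [← Finset.sum_filter, Finset.sum_const]
  change _ = (schurCoeff γ μ).toNat • schur μ m
  rw [schur_eq_card m K hK 𝒮 h𝒮, nsmul_eq_mul, nsmul_eq_mul,
    Int.toNat_of_nonneg (schurCoeff_nonneg hγ hpos μ), mul_comm]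

end Positivity

end NCSchur

theorem theorem2p11 (N : ℕ) :
    (∀ μ : YoungDiagram, NCSchur.IsMonomialPositive (NCSchur.idealB N) (NCSchur.ncSchur N μ)) ∧
    (∀ (l : ℕ) (α n : Fin l → ℕ),
      (∀ j k : Fin l, (k : ℕ) = j + 1 → α k ≤ α j + 1) →
      Monotone n → (∀ j, n j ≤ N) →
      NCSchur.flaggedSchur N α n -
        ∑ T ∈ NCSchur.flaggedSSYT N α n, NCSchur.mon (NCSchur.diagread T) ∈ NCSchur.idealB N) ∧
    (∀ γ : NCSchur.UStar N, NCSchur.IsNonneg γ → NCSchur.IsOrthogonal (NCSchur.idealB N) γ →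
      NCSchur.IsSchurPositive (NCSchur.F γ)) := by
  refine ⟨fun μ => ?_, fun l α n hα hn hN => ?_, fun γ hpos hγ => ?_⟩
  · rw [NCSchur.ncSchur_eq_flaggedSchur]
    exact NCSchur.isMonomialPositive_flaggedSchur N _ _
      (fun j k hjk => (μ.colLen_anti j k (by omega)).trans (Nat.le_succ _)) (fun _ _ _ => le_rfl)
      fun _ => le_rfl
  · exact (NCSchur.toQuot_eq_iff _ _).1 (NCSchur.toQuot_flaggedSchur_eq_sum N α n hα hn hN)
  · exact NCSchur.isSchurPositive_F hpos hγ
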